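/- For a ring $\Lambda$ let $\Lambda\text{-Mod}$ denote the category of left $\Lambda$-modules. A $\Lambda$-module is \emph{Gorenstein projective} if it is isomorphic to $\operatorname{Ker}(Q_0\to Q_{-1})$ for some exact complex $\cdots\to Q_1\to Q_0\to Q_{-1}\to\cdots$ of projective $\Lambda$-modules that remains exact after applying $\operatorname{Hom}_\Lambda(-,Q)$ for every projective $\Lambda$-module $Q$; $\mathcal{GP}(\Lambda\text{-Mod})$ denotes the class of these modules. Let $\Omega^\infty(\Lambda\text{-Mod})$ be the class of modules $X$ admitting an exact sequence $0\to X\to Q_0\to Q_{-1}\to Q_{-2}\to\cdots$ with all $Q_i$ projective. The ring $\Lambda$ is \emph{Iwanaga--Gorenstein} if it is left and right noetherian and has finite injective dimension both as a left and as a right module over itself. Let $k$ be a field, let $\Lambda_1$ be a finite-dimensional $k$-algebra and let $\Lambda_2$ be a $k$-algebra. Regard $\operatorname{Hom}_k(\Lambda_1,k)$ as a right $\Lambda_1$-module via $(\varphi a)(x)=\varphi(ax)$. For a left $(\Lambda_1\otimes_k\Lambda_2)$-module $M$ let ${}_{\Lambda_1}M$ be its restriction along $a\mapsto a\otimes 1$,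 and let $\Lambda_2$ act on $\operatorname{Hom}_k(\Lambda_1,k)\otimes_{\Lambda_1}M$ by $b(\varphi\otimes m)=\varphi\otimes(1\otimes b)m$. Suppose that at least one of the following holds: (1) $\Omega^\infty(\Lambda_1\text{-Mod})\subset\mathcal{GP}(\Lambda_1\text{-Mod})$; (2) $\mathcal{GP}(\Lambda_2\text{-Mod})=\{X\in\Lambda_2\text{-Mod}\mid \operatorname{Ext}^1_{\Lambda_2}(X,Y)=0\text{ for all }Y\in\Lambda_2\text{-Mod}\text{ of finite projective dimension}\}$. Then \[ \mathcal{GP}((\Lambda_1\otimes_k\Lambda_2)\text{-Mod})=\{M\mid {}_{\Lambda_1}M\in\mathcal{GP}(\Lambda_1\text{-Mod})\text{ and }{}_{\Lambda_2}(\operatorname{Hom}_k(\Lambda_1,k)\otimes_{\Lambda_1}M)\in\mathcal{GP}(\Lambda_2\text{-Mod})\}, \] where $M$ ranges over all left $(\Lambda_1\otimes_k\Lambda_2)$-modules. In particular, this equality holds if $\Lambda_1$ or $\Lambda_2$ is Iwanaga--Gorenstein. -/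

import Mathlib

open CategoryTheory CategoryTheory.Limits
open scoped TensorProduct

universe v u

section GorensteinHomologicalAlgebra

variable {C : Type u} [Category.{v} C] [Abelian C]

/-- A totally acyclic complex: an acyclic complex of projective objects
`⋯ ⟶ Q₁ ⟶ Q₀ ⟶ Q₋₁ ⟶ ⋯` that stays acyclic under `Hom(-, Q)` for every projective `Q`.
Acyclicity of `Hom(Q_•, Q)` at `Hom(Q_i, Q)` is spelled out: each cocycle, that is each `g` whose
precomposition with the differential `Q_{i+1} ⟶ Q_i` vanishes, is a coboundary, that is
it factors through the differential `Q_i ⟶ Q_{i-1}`. -/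
structure IsTotallyAcyclic (Q : ChainComplex C ℤ) : Prop where
  projective : ∀ i : ℤ, Projective (Q.X i)
  acyclic : Q.Acyclic
  hom_acyclic : ∀ P : C, Projective P → ∀ (i : ℤ) (g : Q.X i ⟶ P),
    Q.d (i + 1) i ≫ g = 0 → ∃ h : Q.X (i - 1) ⟶ P, Q.d i (i - 1) ≫ h = g

/-- An object is Gorenstein projective if it is (isomorphic to) the object of
cycles `Z₀(Q_•) = Ker (Q₀ ⟶ Q₋₁)` of a totally acyclic complex. -/
def IsGorensteinProjective (X : C) : Prop :=
  ∃ Q : ChainComplex C ℤ, IsTotallyAcyclic Q ∧ Nonempty (X ≅ Q.cycles 0)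

/-- The class `Ω^∞` of all objects `X` for which there is an exact sequence
`0 ⟶ X ⟶ Q⁰ ⟶ Q¹ ⟶ ⋯` with every `Qⁱ` projective. -/
def IsInfiniteSyzygy (X : C) : Prop :=
  ∃ Q : CochainComplex C ℕ, (∀ n, Projective (Q.X n)) ∧ (∀ n, Q.ExactAt (n + 1)) ∧
    Nonempty (X ≅ Q.cycles 0)

/-- Finite projective dimension (the zero object included). -/
def HasFiniteProjectiveDimension (X : C) : Prop :=
  ∃ n : ℕ, HasProjectiveDimensionLE X n

end GorensteinHomologicalAlgebra

/-- A ring is Iwanaga–Gorenstein if it is noetherian on both sides and has finite injective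
dimension as a left and as a right module over itself. -/
def IsIwanagaGorenstein (R : Type u) [Ring R] : Prop :=
  IsNoetherianRing R ∧ IsNoetherianRing Rᵐᵒᵖ ∧
    (∃ n : ℕ, HasInjectiveDimensionLE (ModuleCat.of.{u} R R) n) ∧
    (∃ n : ℕ, HasInjectiveDimensionLE (ModuleCat.of.{u} Rᵐᵒᵖ R) n)

section TensorAlgebras

variable (k Λ₁ Λ₂ : Type u) [Field k] [Ring Λ₁] [Algebra k Λ₁] [Ring Λ₂] [Algebra k Λ₂]

/-- The underlying `Λ₁`-module of a `Λ₁ ⊗ Λ₂`-module, along `a ↦ a ⊗ 1`. -/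
noncomputable abbrev resLeft (M : ModuleCat.{u} (Λ₁ ⊗[k] Λ₂)) : ModuleCat.{u} Λ₁ :=
  (ModuleCat.restrictScalars
    (Algebra.TensorProduct.includeLeft : Λ₁ →ₐ[k] Λ₁ ⊗[k] Λ₂).toRingHom).obj M

/-- The underlying `Λ₂`-module of a `Λ₁ ⊗ Λ₂`-module, along `b ↦ 1 ⊗ b`. -/
noncomputable abbrev resRight (M : ModuleCat.{u} (Λ₁ ⊗[k] Λ₂)) : ModuleCat.{u} Λ₂ :=
  (ModuleCat.restrictScalars
    (Algebra.TensorProduct.includeRight : Λ₂ →ₐ[k] Λ₁ ⊗[k] Λ₂).toRingHom).obj M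

/-- The relations `a m ⊗ φ = m ⊗ φ a` (`a ∈ Λ₁`, `m ∈ M`, `φ ∈ Hom_k(Λ₁, k)`) that cut
`Hom_k(Λ₁, k) ⊗_{Λ₁} M` out of the tensor product over the integers, where `Hom_k(Λ₁, k)` is a
right `Λ₁`-module by `(φ a)(x) = φ (a x)`. The factors are written in the opposite order, since
the action of `Λ₂` on the tensor product comes from `M`. The `Λ₂`-span of the relations is
their additive span, because the actions of `Λ₁` and `Λ₂` on `M` commute. -/
noncomputable def dualTensorRel (M : ModuleCat.{u} (Λ₁ ⊗[k] Λ₂)) :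
    Submodule Λ₂ (resRight k Λ₁ Λ₂ M ⊗[ℤ] Module.Dual k Λ₁) :=
  Submodule.span Λ₂ {t | ∃ (a : Λ₁) (m : M) (φ : Module.Dual k Λ₁),
    t = TensorProduct.tmul ℤ (M := resRight k Λ₁ Λ₂ M) ((a ⊗ₜ[k] (1 : Λ₂)) • m : M) φ -
      TensorProduct.tmul ℤ (M := resRight k Λ₁ Λ₂ M) m (φ ∘ₗ LinearMap.mulLeft k a)}

/-- The `Λ₂`-module `Hom_k(Λ₁, k) ⊗_{Λ₁} M` of a `Λ₁ ⊗ Λ₂`-module `M`. -/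
noncomputable def dualTensor (M : ModuleCat.{u} (Λ₁ ⊗[k] Λ₂)) : ModuleCat.{u} Λ₂ :=
  ModuleCat.of Λ₂ ((resRight k Λ₁ Λ₂ M ⊗[ℤ] Module.Dual k Λ₁) ⧸ dualTensorRel k Λ₁ Λ₂ M)

end TensorAlgebras

/-! Write D = Hom_k(Λ₁, k). Since Λ₁ is finite-dimensional, Hom_k(D, Y) = Λ₁ ⊗ Y, so D ⊗_{Λ₁} - is
left adjoint to Λ₁ ⊗_k -: maps D ⊗ M → Y over Λ₂ are maps M → Λ₁ ⊗ Y over Λ₁ ⊗ Λ₂, and, forgetting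
Λ₂, k-linear maps D ⊗ M → V are Λ₁-linear maps M → Λ₁ ⊗ V. Every projective module over Λ₁ ⊗ Λ₂ or
Λ₁ is a summand of one of the form Λ₁ ⊗ Y (Y free over Λ₂) or Λ₁ ⊗ V. Extension problems along f
into projectives therefore become extension problems along D ⊗ f (`extends_induced_iff`), and over
Λ₁ they are governed by injectivity of D ⊗ f (`extends_resLeftMap_of_injective`,
`dualTensorMap_injective`).

The Gorenstein projectives form the largest class closed under proper syzygies and cosyzygies
(`isGorensteinProjective_of_isProperSyzygy`). The modules M satisfying the two conditions on the
right form such a class: syzygies come from free covers, and a cosyzygy is the cokernel of the map M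
→ Λ₁ ⊗ Y adjoint to an embedding of D ⊗ M into a projective Y.

Conversely, let 0 → A → P → X → 0 have P projective and A, X Gorenstein projective. It is enough
that D ⊗ A → D ⊗ P is injective. Under (1), X is an infinite syzygy over Λ₁, hence Gorenstein
projective there, so all maps A → Λ₁ ⊗ V extend to P. Under (2), dimension shifting gives Ext¹(D ⊗
A, Y) = 0 for Y of finite projective dimension, so D ⊗ A is Gorenstein projective and embeds in a
projective Y; the embedding extends to D ⊗ P because Ext¹(X, Λ₁ ⊗ Y) = 0.

Over an Iwanaga–Gorenstein ring, projectives have bounded injective dimension, which makes infinite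
syzygies Ext-orthogonal to projectives and gives (1). Injectives have bounded projective dimension,
so every module is a quotient of a Gorenstein projective by a module of finite projective dimension;
for X as in (2) this quotient map splits. -/

/-! ### Short exact sequences and long exact sequences of Ext -/

section ShortExactSequences

variable {R : Type u} [Ring R]

/-- A short exact sequence `0 → A → P → X → 0` of modules. -/
structure IsShortExact {A P X : Type*} [AddCommGroup A] [Module R A] [AddCommGroup P] [Module R P]
    [AddCommGroup X] [Module R X] (f : A →ₗ[R] P) (g : P →ₗ[R] X) : Prop where
  inj : Function.Injective f
  exact : Function.Exact f g
  surj : Function.Surjective g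

/-- `Ext^i_R(X, L) = 0`. -/
def ExtVanishes (R : Type u) [Ring R] (X L : Type u) [AddCommGroup X] [Module R X]
    [AddCommGroup L] [Module R L] (i : ℕ) : Prop :=
  Subsingleton (Abelian.Ext (ModuleCat.of R X) (ModuleCat.of R L) i)

/-- Every linear map `A → L` extends along `f : A → P`. -/
def Extends {A P : Type*} [AddCommGroup A] [Module R A] [AddCommGroup P] [Module R P]
    (f : A →ₗ[R] P) (L : Type*) [AddCommGroup L] [Module R L] : Prop :=
  ∀ h : A →ₗ[R] L, ∃ h' : P →ₗ[R] L, h' ∘ₗ f = h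

variable {A P X L X' : Type u} [AddCommGroup A] [Module R A] [AddCommGroup P] [Module R P]
  [AddCommGroup X] [Module R X] [AddCommGroup L] [Module R L] [AddCommGroup X'] [Module R X']
  {f : A →ₗ[R] P} {g : P →ₗ[R] X}

theorem IsShortExact.comp_eq_zero (h : IsShortExact f g) : g ∘ₗ f = 0 :=
  h.exact.linearMap_comp_eq_zero

theorem IsShortExact.apply_apply (h : IsShortExact f g) (a : A) : g (f a) = 0 :=
  h.exact.apply_apply_eq_zero a

theorem isShortExact_mkQ (hf : Function.Injective f) : IsShortExact f (LinearMap.range f).mkQ :=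
  ⟨hf, f.exact_map_mkQ_range, Submodule.mkQ_surjective _⟩

theorem isShortExact_subtype (hg : Function.Surjective g) :
    IsShortExact (LinearMap.ker g).subtype g :=
  ⟨Subtype.val_injective, g.exact_subtype_ker_map, hg⟩

theorem exists_isShortExact_free (R : Type u) [Ring R] (X : Type u) [AddCommGroup X] [Module R X] :
    ∃ (A : ModuleCat.{u} R) (f : A →ₗ[R] (X →₀ R)) (g : (X →₀ R) →ₗ[R] X), IsShortExact f g :=
  ⟨ModuleCat.of R (LinearMap.ker (Finsupp.linearCombination R (id : X → X))), _, _,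
    isShortExact_subtype (Finsupp.linearCombination_id_surjective R X)⟩

/-- The short complex of a short exact sequence. -/
abbrev IsShortExact.shortComplex (h : IsShortExact f g) : ShortComplex (ModuleCat.{u} R) :=
  ShortComplex.mk (ModuleCat.ofHom f) (ModuleCat.ofHom g) (by
    rw [← ModuleCat.ofHom_comp, h.comp_eq_zero]; rfl)

theorem IsShortExact.shortExact (h : IsShortExact f g) : h.shortComplex.ShortExact where
  exact := by
    rw [ShortComplex.ShortExact.moduleCat_exact_iff_function_exact]
    exact h.exact
  mono_f := (ModuleCat.mono_iff_injective _).2 h.inj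
  epi_g := (ModuleCat.epi_iff_surjective _).2 h.surj

theorem ExtVanishes.of_projective [Module.Projective R P] (i : ℕ) : ExtVanishes R P L (i + 1) :=
  have := (IsProjective.iff_projective (R := R) P).1 inferInstance
  Abelian.Ext.subsingleton_of_projective _ _ _

theorem ExtVanishes.of_injective [Module.Injective R L] (i : ℕ) : ExtVanishes R X L (i + 1) :=
  have := Module.injective_object_of_injective_module R L
  Abelian.Ext.subsingleton_of_injective _ _ _

theorem IsShortExact.extends_of_extVanishes (h : IsShortExact f g) (hX : ExtVanishes R X L 1) :
    Extends f L := by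
  intro a
  have : Subsingleton (Abelian.Ext h.shortComplex.X₃ (ModuleCat.of R L) 1) := hX
  obtain ⟨y, hy⟩ := Abelian.Ext.contravariant_sequence_exact₁ h.shortExact (ModuleCat.of R L)
    (Abelian.Ext.mk₀ (ModuleCat.ofHom a)) (n₁ := 1) rfl (Subsingleton.elim _ _)
  obtain ⟨b, rfl⟩ := (Abelian.Ext.mk₀_bijective _ _).2 y
  rw [Abelian.Ext.mk₀_comp_mk₀] at hy
  have := (Abelian.Ext.mk₀_bijective _ _).1 hy
  exact ⟨b.hom, congrArg ModuleCat.Hom.hom this⟩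

/-- Every class in Ext¹(X, L) is the image of some A → L under the connecting map, which kills maps
that extend to P. -/
theorem IsShortExact.extVanishes_one (h : IsShortExact f g) (hP : ExtVanishes R P L 1)
    (hL : Extends f L) : ExtVanishes R X L 1 := by
  have : Subsingleton (Abelian.Ext h.shortComplex.X₂ (ModuleCat.of R L) 1) := hP
  refine subsingleton_of_forall_eq 0 fun x => ?_
  obtain ⟨y, rfl⟩ := Abelian.Ext.contravariant_sequence_exact₃ h.shortExact (ModuleCat.of R L)
    x (Subsingleton.elim _ _) (n₀ := 0) rfl
  obtain ⟨a, rfl⟩ := (Abelian.Ext.mk₀_bijective _ _).2 y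
  obtain ⟨b, hb⟩ := hL a.hom
  have : a = ModuleCat.ofHom f ≫ ModuleCat.ofHom b := by ext x; simp [← hb]
  rw [this, ← Abelian.Ext.mk₀_comp_mk₀,
    ← Abelian.Ext.comp_assoc_of_second_deg_zero h.shortExact.extClass]
  have h0 := h.shortExact.extClass_comp
  erw [h0]
  rw [Abelian.Ext.zero_comp]

theorem IsShortExact.extVanishes_left (h : IsShortExact f g) {i : ℕ} (hP : ExtVanishes R P L i)
    (hX : ExtVanishes R X L (i + 1)) : ExtVanishes R A L i := by
  have : Subsingleton (Abelian.Ext h.shortComplex.X₂ (ModuleCat.of R L) i) := hP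
  have : Subsingleton (Abelian.Ext h.shortComplex.X₃ (ModuleCat.of R L) (i + 1)) := hX
  refine subsingleton_of_forall_eq 0 fun x => ?_
  obtain ⟨y, rfl⟩ := Abelian.Ext.contravariant_sequence_exact₁ h.shortExact (ModuleCat.of R L)
    x (add_comm _ _) (Subsingleton.elim _ _)
  rw [Subsingleton.elim y 0, Abelian.Ext.comp_zero]

theorem IsShortExact.extVanishes_mid (h : IsShortExact f g) {i : ℕ} (hA : ExtVanishes R A L i)
    (hX : ExtVanishes R X L i) : ExtVanishes R P L i := by
  have : Subsingleton (Abelian.Ext h.shortComplex.X₁ (ModuleCat.of R L) i) := hA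
  have : Subsingleton (Abelian.Ext h.shortComplex.X₃ (ModuleCat.of R L) i) := hX
  refine subsingleton_of_forall_eq 0 fun x => ?_
  obtain ⟨y, rfl⟩ := Abelian.Ext.contravariant_sequence_exact₂ h.shortExact (ModuleCat.of R L)
    x (Subsingleton.elim _ _)
  rw [Subsingleton.elim y 0, Abelian.Ext.comp_zero]

theorem IsShortExact.extVanishes_right (h : IsShortExact f g) {i : ℕ} (hA : ExtVanishes R A L i)
    (hP : ExtVanishes R P L (i + 1)) : ExtVanishes R X L (i + 1) := by
  have : Subsingleton (Abelian.Ext h.shortComplex.X₁ (ModuleCat.of R L) i) := hA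
  have : Subsingleton (Abelian.Ext h.shortComplex.X₂ (ModuleCat.of R L) (i + 1)) := hP
  refine subsingleton_of_forall_eq 0 fun x => ?_
  obtain ⟨y, rfl⟩ := Abelian.Ext.contravariant_sequence_exact₃ h.shortExact (ModuleCat.of R L)
    x (Subsingleton.elim _ _) (add_comm _ _)
  rw [Subsingleton.elim y 0, Abelian.Ext.comp_zero]

variable {K : Type u} [AddCommGroup K] [Module R K]

theorem IsShortExact.extVanishes_target_right (h : IsShortExact f g) {i : ℕ}
    (hP : ExtVanishes R K P i) (hA : ExtVanishes R K A (i + 1)) : ExtVanishes R K X i := by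
  have : Subsingleton (Abelian.Ext (ModuleCat.of R K) h.shortComplex.X₂ i) := hP
  have : Subsingleton (Abelian.Ext (ModuleCat.of R K) h.shortComplex.X₁ (i + 1)) := hA
  refine subsingleton_of_forall_eq 0 fun x => ?_
  obtain ⟨y, rfl⟩ := Abelian.Ext.covariant_sequence_exact₃ (ModuleCat.of R K) h.shortExact
    x rfl (Subsingleton.elim _ _)
  rw [Subsingleton.elim y 0, Abelian.Ext.zero_comp]

theorem IsShortExact.extVanishes_target_left (h : IsShortExact f g) {i : ℕ}
    (hX : ExtVanishes R K X i) (hP : ExtVanishes R K P (i + 1)) : ExtVanishes R K A (i + 1) := by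
  have : Subsingleton (Abelian.Ext (ModuleCat.of R K) h.shortComplex.X₂ (i + 1)) := hP
  have : Subsingleton (Abelian.Ext (ModuleCat.of R K) h.shortComplex.X₃ i) := hX
  refine subsingleton_of_forall_eq 0 fun x => ?_
  obtain ⟨y, rfl⟩ := Abelian.Ext.covariant_sequence_exact₁ (ModuleCat.of R K) h.shortExact
    x (Subsingleton.elim _ _) rfl
  rw [Subsingleton.elim y 0, Abelian.Ext.zero_comp]

theorem ExtVanishes.of_retract {i : ℕ} (h : ExtVanishes R X L i) (s : X' →ₗ[R] X)
    (r : X →ₗ[R] X') (hrs : r ∘ₗ s = LinearMap.id) : ExtVanishes R X' L i := by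
  have : Subsingleton (Abelian.Ext (ModuleCat.of R X) (ModuleCat.of R L) i) := h
  refine subsingleton_of_forall_eq 0 fun x => ?_
  have e : (Abelian.Ext.mk₀ (ModuleCat.ofHom s)).comp
      ((Abelian.Ext.mk₀ (ModuleCat.ofHom r)).comp x (zero_add i)) (zero_add i) = x := by
    rw [Abelian.Ext.mk₀_comp_mk₀_assoc, ← ModuleCat.ofHom_comp, hrs]
    exact Abelian.Ext.mk₀_id_comp x
  rw [← e, Subsingleton.elim ((Abelian.Ext.mk₀ (ModuleCat.ofHom r)).comp x (zero_add i)) 0,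
    Abelian.Ext.comp_zero]

/-- A map out of the middle term that vanishes on the first descends to the last. -/
theorem IsShortExact.exists_desc (h : IsShortExact f g) (a : P →ₗ[R] L) (ha : a ∘ₗ f = 0) :
    ∃ b : X →ₗ[R] L, b ∘ₗ g = a := by
  have hk : LinearMap.ker g ≤ LinearMap.ker a := by
    intro p hp
    obtain ⟨x, rfl⟩ := (h.exact p).1 hp
    exact LinearMap.congr_fun ha x
  refine ⟨(LinearMap.ker g).liftQ a hk ∘ₗ (g.quotKerEquivOfSurjective h.surj).symm, ?_⟩
  ext p
  have : (g.quotKerEquivOfSurjective h.surj).symm (g p) = (LinearMap.ker g).mkQ p := by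
    rw [LinearEquiv.symm_apply_eq]; rfl
  simp [this]

/-- A map into the middle term that vanishes in the last lifts to the first. -/
theorem IsShortExact.exists_lift (h : IsShortExact f g) (a : L →ₗ[R] P) (ha : g ∘ₗ a = 0) :
    ∃ b : L →ₗ[R] A, f ∘ₗ b = a := by
  have hk : ∀ x, a x ∈ LinearMap.range f := fun x => (h.exact _).1 (LinearMap.congr_fun ha x)
  refine ⟨(LinearEquiv.ofInjective f h.inj).symm ∘ₗ a.codRestrict _ hk, ?_⟩
  ext x
  simp

end ShortExactSequences

/-! ### Gorenstein projectives via proper syzygies and cosyzygies -/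

section GorensteinProjectiveModules

variable {R : Type u} [Ring R]

/-- The cycles of a complex of modules are the kernel of the differential. -/
theorem nonempty_cycles_iso_ker {ι : Type*} {c : ComplexShape ι}
    (K : HomologicalComplex (ModuleCat.{u} R) c) (i j : ι) (hij : c.next i = j) :
    Nonempty (K.cycles i ≅ ModuleCat.of R (LinearMap.ker (K.d i j).hom)) :=
  ⟨(K.cyclesIsKernel i j hij).conePointUniqueUpToIso (ModuleCat.kernelIsLimit (K.d i j))⟩

theorem range_eq_ker_of_exactAt {ι : Type*} {c : ComplexShape ι}
    (K : HomologicalComplex (ModuleCat.{u} R) c) (i j k : ι) (hi : c.prev j = i) (hk : c.next j = k) :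
    K.ExactAt j ↔ LinearMap.range (K.d i j).hom = LinearMap.ker (K.d j k).hom := by
  rw [K.exactAt_iff' i j k hi hk, ShortComplex.moduleCat_exact_iff_range_eq_ker]
  rfl

/-- `A` is a syzygy of `B` with respect to a projective module into whose maps to projectives
all maps from `A` extend. -/
def IsProperSyzygy (A B : ModuleCat.{u} R) : Prop :=
  ∃ (P : ModuleCat.{u} R) (f : A →ₗ[R] P) (g : P →ₗ[R] B), Module.Projective R P ∧
    IsShortExact f g ∧ ∀ L : ModuleCat.{u} R, Module.Projective R L → Extends f L

theorem range_comp_eq_ker_comp {A P X P' X' : Type*} [AddCommGroup A] [Module R A]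
    [AddCommGroup P] [Module R P] [AddCommGroup X] [Module R X] [AddCommGroup P'] [Module R P']
    [AddCommGroup X'] [Module R X'] {f : A →ₗ[R] P} {g : P →ₗ[R] X} {i : X →ₗ[R] P'}
    {q : X' →ₗ[R] A} (h : IsShortExact f g) (hi : Function.Injective i)
    (hq : Function.Surjective q) : LinearMap.range (f ∘ₗ q) = LinearMap.ker (i ∘ₗ g) := by
  rw [LinearMap.range_comp, LinearMap.range_eq_top.2 hq, Submodule.map_top, LinearMap.ker_comp,
    LinearMap.ker_eq_bot.2 hi, Submodule.comap_bot, LinearMap.exact_iff.1 h.exact]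

/-- The short exact sequences splice to an acyclic complex, and the extension property at each step
is what makes it Hom-acyclic. -/
theorem isGorensteinProjective_of_seq (X : ℤ → ModuleCat.{u} R)
    (h : ∀ n, IsProperSyzygy (X (n + 1)) (X n)) : IsGorensteinProjective (X 1) := by
  choose P f g hP hfg hL using h
  have hd : ∀ n, (ModuleCat.ofHom (f (n + 1) ∘ₗ g (n + 1 + 1)) : P (n + 1 + 1) ⟶ P (n + 1)) ≫
      ModuleCat.ofHom (f n ∘ₗ g (n + 1)) = 0 := by
    intro n
    ext x
    simp [(hfg (n + 1)).apply_apply]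
  let Q : ChainComplex (ModuleCat.{u} R) ℤ :=
    ChainComplex.of P (fun n => ModuleCat.ofHom (f n ∘ₗ g (n + 1))) hd
  have hQ : ∀ n, Q.d (n + 1) n = ModuleCat.ofHom (f n ∘ₗ g (n + 1)) := fun n =>
    ChainComplex.of_d P (fun n => ModuleCat.ofHom (f n ∘ₗ g (n + 1))) n
  refine ⟨Q, ⟨fun i => ?_, fun i => ?_, ?_⟩, ?_⟩
  · have := hP i
    exact (P i).projective_of_categoryTheory_projective
  · obtain ⟨m, rfl⟩ : ∃ m, i = m + 1 := ⟨i - 1, by ring⟩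
    rw [range_eq_ker_of_exactAt Q (m + 1 + 1) (m + 1) m (by simp) (by simp), hQ, hQ]
    exact range_comp_eq_ker_comp (hfg (m + 1)) (hfg m).inj (hfg (m + 1 + 1)).surj
  · intro L hLp i a ha
    obtain ⟨m, rfl⟩ : ∃ m, i = m + 1 := ⟨i - 1, by ring⟩
    rw [add_sub_cancel_right]
    rw [hQ] at ha
    -- Since `g (m + 2)` is onto, a cocycle vanishes on all of `X (m + 2)`. It thus descends to `X
    -- (m + 1)`, and extending that along `f m` gives the primitive.
    have ha' : (a.hom : P (m + 1) →ₗ[R] L) ∘ₗ f (m + 1) = 0 := by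
      ext x
      obtain ⟨y, rfl⟩ := (hfg (m + 1 + 1)).surj x
      exact LinearMap.congr_fun (congrArg ModuleCat.Hom.hom ha) y
    obtain ⟨b, hb⟩ := (hfg (m + 1)).exists_desc (a.hom : P (m + 1) →ₗ[R] L) ha'
    obtain ⟨b', hb'⟩ := hL m L (L.projective_of_module_projective) b
    refine ⟨ModuleCat.ofHom b', ?_⟩
    rw [hQ]
    ext x
    simpa [← hb] using LinearMap.congr_fun hb' (g (m + 1) x)
  · have key : ∀ n, Nonempty (X (n + 1 + 1) ≅ Q.cycles (n + 1)) := by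
      intro n
      obtain ⟨e⟩ := nonempty_cycles_iso_ker Q (n + 1) n (by simp)
      refine ⟨?_ ≪≫ e.symm⟩
      have h2 : LinearMap.ker (Q.d (n + 1) n).hom = LinearMap.range (f (n + 1)) := by
        rw [hQ n, ← LinearMap.exact_iff.1 (hfg (n + 1)).exact]
        exact LinearMap.ker_comp_of_ker_eq_bot _ (LinearMap.ker_eq_bot.2 (hfg n).inj)
      exact ((LinearEquiv.ofInjective (f (n + 1)) (hfg (n + 1)).inj).trans
        (LinearEquiv.ofEq _ _ h2.symm)).toModuleIso
    -- The cycles in degree `0` are the image of `f 0`, whose source is `X 1`.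
    exact key (-1)

/-- A class of modules closed under proper syzygies and cosyzygies consists of Gorenstein
projective modules. -/
theorem isGorensteinProjective_of_isProperSyzygy (S : ModuleCat.{u} R → Prop)
    (hl : ∀ X, S X → ∃ A, S A ∧ IsProperSyzygy A X)
    (hr : ∀ X, S X → ∃ B, S B ∧ IsProperSyzygy X B) (X : ModuleCat.{u} R) (hX : S X) :
    IsGorensteinProjective X := by
  have hl' : ∀ X : Subtype S, ∃ A : Subtype S, IsProperSyzygy A.1 X.1 := fun X =>
    let ⟨A, hA, h⟩ := hl X.1 X.2; ⟨⟨A, hA⟩, h⟩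
  have hr' : ∀ X : Subtype S, ∃ A : Subtype S, IsProperSyzygy X.1 A.1 := fun X =>
    let ⟨A, hA, h⟩ := hr X.1 X.2; ⟨⟨A, hA⟩, h⟩
  choose l hl' using hl'
  choose r hr' using hr'
  -- The given module is placed at index `1`, which becomes the cycles in degree `0`; index `0`
  -- already holds its first cosyzygy.
  let z : ℤ → Subtype S := fun
    | Int.ofNat 0 => r ⟨X, hX⟩
    | Int.ofNat (n + 1) => l^[n] ⟨X, hX⟩
    | Int.negSucc n => r^[n + 1] (r ⟨X, hX⟩)
  refine isGorensteinProjective_of_seq (fun n => (z n).1) fun n => ?_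
  match n with
  | Int.ofNat 0 => exact hr' _
  | Int.ofNat (n + 1) =>
    change IsProperSyzygy (l^[n + 1] ⟨X, hX⟩).1 (l^[n] ⟨X, hX⟩).1
    rw [Function.iterate_succ_apply']
    exact hl' _
  | Int.negSucc 0 => exact hr' _
  | Int.negSucc (n + 1) =>
    have : Int.negSucc (n + 1) + 1 = Int.negSucc n := by omega
    rw [this]
    change IsProperSyzygy (r^[n + 1] (r ⟨X, hX⟩)).1 (r^[n + 1 + 1] (r ⟨X, hX⟩)).1
    rw [Function.iterate_succ_apply' r (n + 1)]
    exact hr' _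

theorem isShortExact_rangeRestrict_ker {A P X : Type*} [AddCommGroup A] [Module R A]
    [AddCommGroup P] [Module R P] [AddCommGroup X] [Module R X] {f : A →ₗ[R] P} {g : P →ₗ[R] X}
    (h : LinearMap.range f = LinearMap.ker g) :
    IsShortExact (LinearMap.ker f).subtype
      (f.codRestrict (LinearMap.ker g) fun x => h ▸ LinearMap.mem_range_self f x) where
  inj := Subtype.val_injective
  exact := by
    intro x
    simp [Subtype.ext_iff]
  surj := by
    rintro ⟨x, hx⟩
    rw [← h] at hx
    obtain ⟨y, rfl⟩ := hx
    exact ⟨y, rfl⟩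

theorem IsShortExact.congr_left {A A' P X : Type*} [AddCommGroup A] [Module R A]
    [AddCommGroup A'] [Module R A']
    [AddCommGroup P] [Module R P] [AddCommGroup X] [Module R X] {f : A →ₗ[R] P} {g : P →ₗ[R] X}
    (h : IsShortExact f g) (e : A' ≃ₗ[R] A) : IsShortExact (f ∘ₗ e.toLinearMap) g where
  inj := h.inj.comp e.injective
  exact := by
    rw [LinearMap.exact_iff, LinearMap.range_comp, LinearEquiv.range, Submodule.map_top,
      LinearMap.exact_iff.1 h.exact]
  surj := h.surj

theorem IsShortExact.congr_right {A X' P X : Type*} [AddCommGroup A] [Module R A]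
    [AddCommGroup X'] [Module R X']
    [AddCommGroup P] [Module R P] [AddCommGroup X] [Module R X] {f : A →ₗ[R] P} {g : P →ₗ[R] X}
    (h : IsShortExact f g) (e : X ≃ₗ[R] X') : IsShortExact f (e.toLinearMap ∘ₗ g) where
  inj := h.inj
  exact := by
    rw [LinearMap.exact_iff, LinearEquiv.ker_comp, LinearMap.exact_iff.1 h.exact]
  surj := e.surjective.comp h.surj

/-- The modules of cycles of totally acyclic complexes. -/
def IsTotallyAcyclicCycles (X : ModuleCat.{u} R) : Prop :=
  ∃ Q : ChainComplex (ModuleCat.{u} R) ℤ, IsTotallyAcyclic Q ∧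
    ∃ i j, j + 1 = i ∧ Nonempty (X ≃ₗ[R] LinearMap.ker (Q.d i j).hom)

theorem IsGorensteinProjective.isTotallyAcyclicCycles {X : ModuleCat.{u} R}
    (h : IsGorensteinProjective X) : IsTotallyAcyclicCycles X := by
  obtain ⟨Q, hQ, ⟨e⟩⟩ := h
  obtain ⟨e'⟩ := nonempty_cycles_iso_ker Q 0 (-1) (by simp)
  exact ⟨Q, hQ, 0, -1, by norm_num, ⟨(e ≪≫ e').toLinearEquiv⟩⟩

theorem IsTotallyAcyclic.isProperSyzygy {Q : ChainComplex (ModuleCat.{u} R) ℤ}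
    (hQ : IsTotallyAcyclic Q) (n : ℤ) {A X : ModuleCat.{u} R}
    (e : A ≃ₗ[R] LinearMap.ker (Q.d (n + 1 + 1) (n + 1)).hom)
    (e' : X ≃ₗ[R] LinearMap.ker (Q.d (n + 1) n).hom) :
    IsProperSyzygy A X := by
  have hx := (range_eq_ker_of_exactAt Q (n + 1 + 1) (n + 1) n (by simp) (by simp)).1
    (hQ.acyclic (n + 1))
  refine ⟨Q.X (n + 1 + 1), _, _, ?_, ((isShortExact_rangeRestrict_ker hx).congr_left e).congr_right
    e'.symm, ?_⟩
  · have := hQ.projective (n + 1 + 1)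
    exact (Q.X (n + 1 + 1)).projective_of_module_projective
  · intro L hL a
    have hL' : Projective L := L.projective_of_categoryTheory_projective
    have hx' := (range_eq_ker_of_exactAt Q (n + 1 + 1 + 1) (n + 1 + 1) (n + 1)
      (by simp) (by simp)).1 (hQ.acyclic (n + 1 + 1))
    -- Composing a map on cycles with the surjection `q` onto them yields a cocycle, and a primitive
    -- of this cocycle is the desired extension.
    let q := (Q.d (n + 1 + 1 + 1) (n + 1 + 1)).hom.codRestrict
      (LinearMap.ker (Q.d (n + 1 + 1) (n + 1)).hom)
      fun x => hx' ▸ LinearMap.mem_range_self (Q.d (n + 1 + 1 + 1) (n + 1 + 1)).hom x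
    have key := hQ.hom_acyclic L hL' (n + 1 + 1 + 1) (ModuleCat.ofHom (a ∘ₗ e.symm.toLinearMap ∘ₗ q))
      (by
        ext x
        have : q ((Q.d (n + 1 + 1 + 1 + 1) (n + 1 + 1 + 1)).hom x) = 0 := by
          ext
          exact LinearMap.congr_fun (congrArg ModuleCat.Hom.hom
            (Q.d_comp_d (n + 1 + 1 + 1 + 1) (n + 1 + 1 + 1) (n + 1 + 1))) x
        simp [this])
    rw [add_sub_cancel_right] at key
    obtain ⟨b, hb⟩ := key
    refine ⟨b.hom, ?_⟩
    ext x
    obtain ⟨⟨y, hy⟩, rfl⟩ := e.symm.surjective x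
    obtain ⟨z, rfl⟩ : y ∈ LinearMap.range (Q.d (n + 1 + 1 + 1) (n + 1 + 1)).hom := hx' ▸ hy
    have := LinearMap.congr_fun (congrArg ModuleCat.Hom.hom hb) z
    simpa using! this

theorem IsTotallyAcyclicCycles.exists_syzygy {X : ModuleCat.{u} R} (h : IsTotallyAcyclicCycles X) :
    ∃ A, IsTotallyAcyclicCycles A ∧ IsProperSyzygy A X := by
  obtain ⟨Q, hQ, _, n, rfl, ⟨e⟩⟩ := h
  exact ⟨ModuleCat.of R (LinearMap.ker (Q.d (n + 1 + 1) (n + 1)).hom),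
    ⟨Q, hQ, _, n + 1, rfl, ⟨LinearEquiv.refl _ _⟩⟩, hQ.isProperSyzygy n (LinearEquiv.refl _ _) e⟩

theorem IsTotallyAcyclicCycles.exists_cosyzygy {X : ModuleCat.{u} R}
    (h : IsTotallyAcyclicCycles X) : ∃ B, IsTotallyAcyclicCycles B ∧ IsProperSyzygy X B := by
  obtain ⟨Q, hQ, _, n, rfl, ⟨e⟩⟩ := h
  obtain ⟨m, rfl⟩ : ∃ m, n = m + 1 := ⟨n - 1, by ring⟩
  exact ⟨ModuleCat.of R (LinearMap.ker (Q.d (m + 1) m).hom),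
    ⟨Q, hQ, _, m, rfl, ⟨LinearEquiv.refl _ _⟩⟩, hQ.isProperSyzygy m e (LinearEquiv.refl _ _)⟩

/-- This makes the choice of degree `0` in the definition irrelevant: rather than shifting the
complex, a new one is spliced together from the closure of all cycles under proper syzygies and
cosyzygies. -/
theorem IsTotallyAcyclicCycles.isGorensteinProjective {X : ModuleCat.{u} R}
    (h : IsTotallyAcyclicCycles X) : IsGorensteinProjective X :=
  isGorensteinProjective_of_isProperSyzygy _ (fun _ h => h.exists_syzygy)
    (fun _ h => h.exists_cosyzygy) X h

theorem IsGorensteinProjective.exists_syzygy {X : ModuleCat.{u} R} (h : IsGorensteinProjective X) :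
    ∃ A, IsGorensteinProjective A ∧ IsProperSyzygy A X :=
  let ⟨A, hA, hAX⟩ := h.isTotallyAcyclicCycles.exists_syzygy
  ⟨A, hA.isGorensteinProjective, hAX⟩

theorem IsGorensteinProjective.exists_cosyzygy {X : ModuleCat.{u} R}
    (h : IsGorensteinProjective X) : ∃ B, IsGorensteinProjective B ∧ IsProperSyzygy X B :=
  let ⟨A, hA, hAX⟩ := h.isTotallyAcyclicCycles.exists_cosyzygy
  ⟨A, hA.isGorensteinProjective, hAX⟩

end GorensteinProjectiveModules

/-! ### Closure properties of Gorenstein projectives; infinite syzygies -/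

section GorensteinProjectiveClosure

variable {R : Type u} [Ring R]

/-- The modules `X` with `Ext^i(X, L) = 0` for all `i ≥ 1` and all projective `L`. -/
def IsExtOrthogonal (X : ModuleCat.{u} R) : Prop :=
  ∀ L : ModuleCat.{u} R, Module.Projective R L → ∀ i, ExtVanishes R X L (i + 1)

/-- `X` embeds into a projective module with cokernel in the class `S`. -/
def HasCosyzygyIn (S : ModuleCat.{u} R → Prop) (X : ModuleCat.{u} R) : Prop :=
  ∃ (P B : ModuleCat.{u} R) (f : X →ₗ[R] P) (g : P →ₗ[R] B), Module.Projective R P ∧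
    IsShortExact f g ∧ S B

theorem HasCosyzygyIn.mono {S T : ModuleCat.{u} R → Prop} {X : ModuleCat.{u} R}
    (h : HasCosyzygyIn S X) (hST : ∀ Y, S Y → T Y) : HasCosyzygyIn T X :=
  let ⟨P, B, f, g, hP, hfg, hB⟩ := h
  ⟨P, B, f, g, hP, hfg, hST B hB⟩

theorem IsExtOrthogonal.isProperSyzygy {A P X : ModuleCat.{u} R} (hX : IsExtOrthogonal X)
    {f : A →ₗ[R] P} {g : P →ₗ[R] X} (h : IsShortExact f g) (hP : Module.Projective R P) :
    IsProperSyzygy A X :=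
  ⟨P, f, g, hP, h, fun L hL => h.extends_of_extVanishes (hX L hL 0)⟩

theorem IsExtOrthogonal.of_syzygy {A P X : ModuleCat.{u} R} (hX : IsExtOrthogonal X)
    {f : A →ₗ[R] P} {g : P →ₗ[R] X} (h : IsShortExact f g) (hP : Module.Projective R P) :
    IsExtOrthogonal A :=
  fun L hL i => h.extVanishes_left (ExtVanishes.of_projective i) (hX L hL (i + 1))

/-- Dimension shifting: proper syzygies handle Ext¹, and higher Ext of X is lower Ext of a syzygy
that is again in S. -/
theorem isExtOrthogonal_of_exists_syzygy (S : ModuleCat.{u} R → Prop)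
    (hS : ∀ X, S X → ∃ A, S A ∧ IsProperSyzygy A X) {X : ModuleCat.{u} R} (hX : S X) :
    IsExtOrthogonal X := by
  intro L hL i
  induction i generalizing X with
  | zero =>
    obtain ⟨A, hA, P, f, g, hP, hfg, hp⟩ := hS X hX
    exact hfg.extVanishes_one (ExtVanishes.of_projective 0) (hp L hL)
  | succ i ih =>
    obtain ⟨A, hA, P, f, g, hP, hfg, hp⟩ := hS X hX
    exact hfg.extVanishes_right (ih hA) (ExtVanishes.of_projective (i + 1))

theorem IsGorensteinProjective.isExtOrthogonal {X : ModuleCat.{u} R}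
    (h : IsGorensteinProjective X) : IsExtOrthogonal X :=
  isExtOrthogonal_of_exists_syzygy _ (fun _ h => h.exists_syzygy) h

theorem IsGorensteinProjective.hasCosyzygyIn {X : ModuleCat.{u} R}
    (h : IsGorensteinProjective X) : HasCosyzygyIn IsGorensteinProjective X :=
  let ⟨B, hB, P, f, g, hP, hfg, _⟩ := h.exists_cosyzygy
  ⟨P, B, f, g, hP, hfg, hB⟩

/-- A class of modules that are `Ext`-orthogonal to the projectives and embed into projectives
with cokernels in the class consists of Gorenstein projective modules. -/
theorem isGorensteinProjective_of_hasCosyzygyIn (S : ModuleCat.{u} R → Prop)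
    (hperp : ∀ X, S X → IsExtOrthogonal X) (hS : ∀ X, S X → HasCosyzygyIn S X)
    {X : ModuleCat.{u} R} (hX : S X) : IsGorensteinProjective X := by
  -- S need not contain syzygies. The union T of all admissible classes does, because a syzygy of a
  -- member can be adjoined to its class, with the member as cosyzygy.
  let T : ModuleCat.{u} R → Prop := fun X => ∃ S : ModuleCat.{u} R → Prop,
    (∀ X, S X → IsExtOrthogonal X) ∧ (∀ X, S X → HasCosyzygyIn S X) ∧ S X
  refine isGorensteinProjective_of_isProperSyzygy T ?_ ?_ X ⟨S, hperp, hS, hX⟩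
  · rintro X ⟨S, hperp, hS, hX⟩
    obtain ⟨A, f, g, hfg⟩ := exists_isShortExact_free R X
    have hF : Module.Projective R (ModuleCat.of R (X →₀ R)) :=
      inferInstanceAs (Module.Projective R (X →₀ R))
    refine ⟨A, ⟨fun Y => S Y ∨ Y = A, ?_, ?_, Or.inr rfl⟩,
      (hperp X hX).isProperSyzygy (P := ModuleCat.of R (X →₀ R)) hfg hF⟩
    · rintro Y (hY | rfl)
      · exact hperp Y hY
      · exact (hperp X hX).of_syzygy (P := ModuleCat.of R (X →₀ R)) hfg hF
    · rintro Y (hY | rfl)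
      · exact (hS Y hY).mono fun _ => Or.inl
      · exact ⟨_, X, f, g, hF, hfg, Or.inl hX⟩
  · rintro X ⟨S, hperp, hS, hX⟩
    obtain ⟨P, B, f, g, hP, hfg, hB⟩ := hS X hX
    exact ⟨B, ⟨S, hperp, hS, hB⟩, (hperp B hB).isProperSyzygy hfg hP⟩

theorem IsGorensteinProjective.of_syzygy {A P X : ModuleCat.{u} R} (hX : IsGorensteinProjective X)
    {f : A →ₗ[R] P} {g : P →ₗ[R] X} (h : IsShortExact f g) (hP : Module.Projective R P) :
    IsGorensteinProjective A := by
  refine isGorensteinProjective_of_hasCosyzygyIn (fun Y => IsGorensteinProjective Y ∨ Y = A)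
    ?_ ?_ (Or.inr rfl)
  · rintro Y (hY | rfl)
    · exact hY.isExtOrthogonal
    · exact hX.isExtOrthogonal.of_syzygy h hP
  · rintro Y (hY | rfl)
    · exact hY.hasCosyzygyIn.mono fun _ => Or.inl
    · exact ⟨P, X, f, g, hP, h, Or.inl hX⟩

theorem IsExtOrthogonal.of_retract {X Y : ModuleCat.{u} R} (h : IsExtOrthogonal X)
    (s : Y →ₗ[R] X) (r : X →ₗ[R] Y) (hrs : r ∘ₗ s = LinearMap.id) : IsExtOrthogonal Y :=
  fun L hL i => (h L hL i).of_retract s r hrs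

theorem isShortExact_inl_snd (A X : Type*) [AddCommGroup A] [Module R A] [AddCommGroup X]
    [Module R X] : IsShortExact (LinearMap.inl R A X) (LinearMap.snd R A X) :=
  ⟨LinearMap.inl_injective, Function.Exact.inl_snd, LinearMap.snd_surjective⟩

theorem IsExtOrthogonal.prod {P X : ModuleCat.{u} R} (hP : Module.Projective R P)
    (h : IsExtOrthogonal X) : IsExtOrthogonal (ModuleCat.of R (P × X)) :=
  fun L hL i => (isShortExact_inl_snd (R := R) P X).extVanishes_mid (ExtVanishes.of_projective i)
    (h L hL i)

/-- A retract of the direct sum of a projective and a Gorenstein projective module is Gorenstein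
projective. -/
theorem IsGorensteinProjective.of_retract_prod {P X Z : ModuleCat.{u} R}
    (hP : Module.Projective R P) (hX : IsGorensteinProjective X) (s : Z →ₗ[R] P × X)
    (r : P × X →ₗ[R] Z) (hrs : r ∘ₗ s = LinearMap.id) : IsGorensteinProjective Z := by
  refine isGorensteinProjective_of_hasCosyzygyIn (fun Z => ∃ (P X : ModuleCat.{u} R)
    (s : Z →ₗ[R] P × X) (r : P × X →ₗ[R] Z), Module.Projective R P ∧ IsGorensteinProjective X ∧
      r ∘ₗ s = LinearMap.id) ?_ ?_ ⟨P, X, s, r, hP, hX, hrs⟩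
  · rintro Z ⟨P, X, s, r, hP, hX, hrs⟩
    exact (hX.isExtOrthogonal.prod hP).of_retract (X := ModuleCat.of R (P × X)) s r hrs
  · rintro Z ⟨P, X, s, r, hP, hX, hrs⟩
    obtain ⟨Q, Y, i, p, hQ, hip, hY⟩ := hX.hasCosyzygyIn
    let j : P × X →ₗ[R] P × Q := LinearMap.prodMap LinearMap.id i
    let q : P × Q →ₗ[R] Y := p ∘ₗ LinearMap.snd R P Q
    have hj : IsShortExact j q := by
      refine ⟨?_, ?_, hip.surj.comp LinearMap.snd_surjective⟩
      · exact Function.injective_id.prodMap hip.inj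
      · rintro ⟨a, b⟩
        constructor
        · intro h
          obtain ⟨x, rfl⟩ := (hip.exact b).1 h
          exact ⟨(a, x), rfl⟩
        · rintro ⟨⟨a, x⟩, h⟩
          obtain ⟨rfl, rfl⟩ := Prod.ext_iff.1 h
          exact hip.apply_apply x
    -- The idempotent `s ∘ r` of `P × X` is extended to an endomorphism `t` of `P × Q`, which need
    -- not be idempotent.
    obtain ⟨t, ht⟩ := hj.extends_of_extVanishes
      (hY.isExtOrthogonal (ModuleCat.of R (P × Q)) (inferInstanceAs (Module.Projective R (P × Q))) 0)
      (j ∘ₗ s ∘ₗ r)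
    have hrs' : ∀ z, r (s z) = z := LinearMap.congr_fun hrs
    have ht' : ∀ x, t (j x) = j (s (r x)) := LinearMap.congr_fun ht
    have hjs : Function.Injective (j ∘ₗ s) :=
      hj.inj.comp (Function.LeftInverse.injective hrs')
    have hc := isShortExact_mkQ (R := R) hjs
    set c := (LinearMap.range (j ∘ₗ s)).mkQ with hc_def
    have hcs : ∀ z, c (j (s z)) = 0 := hc.apply_apply
    -- The cokernel of `j ∘ s` is a retract of `(P × Q) × Y`, so the class is closed under
    -- cosyzygies: σ sends the class of w to (w - t w, q w), and with `τ ∘ q = c ∘ t` the return map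
    -- gives c (w - t w) + c (t w) = c w.
    obtain ⟨σ, hσ⟩ := hc.exists_desc (LinearMap.prod (LinearMap.id - t) q) (by
      ext z
      · simp [ht', hrs']
      · simp [ht', hrs']
      · simp [hj.apply_apply])
    obtain ⟨τ, hτ⟩ := hj.exists_desc (c ∘ₗ t) (by
      apply LinearMap.ext
      intro x
      simp [ht', hcs])
    refine ⟨ModuleCat.of R (P × Q), ModuleCat.of R ((P × Q) ⧸ LinearMap.range (j ∘ₗ s)),
      j ∘ₗ s, c, inferInstanceAs (Module.Projective R (P × Q)), hc,
      ModuleCat.of R (P × Q), Y, σ, LinearMap.coprod c τ,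
      inferInstanceAs (Module.Projective R (P × Q)), hY, ?_⟩
    apply LinearMap.ext
    intro w
    obtain ⟨x, rfl⟩ := hc.surj w
    have h1 : σ (c x) = (x - t x, q x) := LinearMap.congr_fun hσ x
    have h2 : τ (q x) = c (t x) := LinearMap.congr_fun hτ x
    simp [h1, h2]

/-- The cokernel of an embedding of a Gorenstein projective module into a projective module is
Gorenstein projective if all maps to projectives extend. -/
theorem IsGorensteinProjective.of_cosyzygy {A P X : ModuleCat.{u} R}
    (hA : IsGorensteinProjective A) {f : A →ₗ[R] P} {g : P →ₗ[R] X} (h : IsShortExact f g)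
    (hP : Module.Projective R P) (hL : ∀ L : ModuleCat.{u} R, Module.Projective R L → Extends f L) :
    IsGorensteinProjective X := by
  obtain ⟨Q, Y, i, p, hQ, hip, hY⟩ := hA.hasCosyzygyIn
  obtain ⟨a, ha⟩ := hL Q hQ i
  obtain ⟨b, hb⟩ := hip.extends_of_extVanishes (hY.isExtOrthogonal P hP 0) f
  have ha' : ∀ x, a (f x) = i x := LinearMap.congr_fun ha
  have hb' : ∀ x, b (i x) = f x := LinearMap.congr_fun hb
  -- As in Schanuel's lemma, the comparison maps a and b between P and Q under A exhibit X as a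
  -- retract of `P × Y`.
  obtain ⟨σ, hσ⟩ := h.exists_desc (LinearMap.prod (LinearMap.id - b ∘ₗ a) (p ∘ₗ a)) (by
    apply LinearMap.ext
    intro x
    simp [ha', hb', hip.apply_apply])
  obtain ⟨τ, hτ⟩ := hip.exists_desc (g ∘ₗ b) (by
    apply LinearMap.ext
    intro x
    simp [hb', h.apply_apply])
  refine hY.of_retract_prod hP σ (LinearMap.coprod g τ) ?_
  apply LinearMap.ext
  intro w
  obtain ⟨x, rfl⟩ := h.surj w
  have h1 : σ (g x) = (x - b (a x), p (a x)) := LinearMap.congr_fun hσ x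
  have h2 : τ (p (a x)) = g (b (a x)) := LinearMap.congr_fun hτ (a x)
  simp [h1, h2]

theorem IsGorensteinProjective.of_retract {X Z : ModuleCat.{u} R} (hX : IsGorensteinProjective X)
    (s : Z →ₗ[R] X) (r : X →ₗ[R] Z) (hrs : r ∘ₗ s = LinearMap.id) : IsGorensteinProjective Z := by
  refine hX.of_retract_prod (P := ModuleCat.of R PUnit.{u + 1})
    (inferInstanceAs (Module.Projective R PUnit.{u + 1})) (LinearMap.prod 0 s)
    (r ∘ₗ LinearMap.snd R PUnit.{u + 1} X) ?_
  rw [← hrs]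
  rfl

/-- A class of modules closed under cosyzygies consists of infinite syzygies. -/
theorem isInfiniteSyzygy_of_hasCosyzygyIn (S : ModuleCat.{u} R → Prop)
    (hS : ∀ X, S X → HasCosyzygyIn S X) {X : ModuleCat.{u} R} (hX : S X) :
    IsInfiniteSyzygy X := by
  have hS' : ∀ X : Subtype S, ∃ B : Subtype S, ∃ (P : ModuleCat.{u} R) (f : X.1 →ₗ[R] P)
      (g : P →ₗ[R] B.1), Module.Projective R P ∧ IsShortExact f g := fun X =>
    let ⟨P, B, f, g, hP, hfg, hB⟩ := hS X.1 X.2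
    ⟨⟨B, hB⟩, P, f, g, hP, hfg⟩
  choose r hr using hS'
  let z : ℕ → Subtype S := fun n => r^[n] ⟨X, hX⟩
  have hz : ∀ n, ∃ (P : ModuleCat.{u} R) (f : (z n).1 →ₗ[R] P)
      (g : P →ₗ[R] (z (n + 1)).1), Module.Projective R P ∧ IsShortExact f g := by
    intro n
    have : z (n + 1) = r (z n) := Function.iterate_succ_apply' r n _
    rw [this]
    exact hr (z n)
  choose P f g hP hfg using hz
  have hd : ∀ n, (ModuleCat.ofHom (f (n + 1) ∘ₗ g n) : P n ⟶ P (n + 1)) ≫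
      ModuleCat.ofHom (f (n + 1 + 1) ∘ₗ g (n + 1)) = 0 := by
    intro n
    ext x
    simp [(hfg (n + 1)).apply_apply]
  let Q : CochainComplex (ModuleCat.{u} R) ℕ :=
    CochainComplex.of P (fun n => ModuleCat.ofHom (f (n + 1) ∘ₗ g n)) hd
  have hQ : ∀ n, Q.d n (n + 1) = ModuleCat.ofHom (f (n + 1) ∘ₗ g n) := fun n =>
    CochainComplex.of_d P (fun n => ModuleCat.ofHom (f (n + 1) ∘ₗ g n)) n
  refine ⟨Q, fun n => ?_, fun n => ?_, ?_⟩
  · have := hP n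
    exact (P n).projective_of_categoryTheory_projective
  · rw [range_eq_ker_of_exactAt Q n (n + 1) (n + 1 + 1) (by simp) (by simp), hQ, hQ]
    exact range_comp_eq_ker_comp (hfg (n + 1)) (hfg (n + 1 + 1)).inj (hfg n).surj
  · obtain ⟨e⟩ := nonempty_cycles_iso_ker Q 0 1 (by simp)
    refine ⟨?_ ≪≫ e.symm⟩
    have h2 : LinearMap.ker (Q.d 0 1).hom = LinearMap.range (f 0) := by
      rw [hQ 0, ← LinearMap.exact_iff.1 (hfg 0).exact]
      exact LinearMap.ker_comp_of_ker_eq_bot _ (LinearMap.ker_eq_bot.2 (hfg 1).inj)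
    exact ((LinearEquiv.ofInjective (f 0) (hfg 0).inj).trans
      (LinearEquiv.ofEq _ _ h2.symm)).toModuleIso

theorem exists_hasCosyzygyIn_of_isInfiniteSyzygy {X : ModuleCat.{u} R} (h : IsInfiniteSyzygy X) :
    ∃ S : ModuleCat.{u} R → Prop, S X ∧ ∀ Y, S Y → HasCosyzygyIn S Y := by
  obtain ⟨Q, hP, hQ, ⟨e⟩⟩ := h
  obtain ⟨e'⟩ := nonempty_cycles_iso_ker Q 0 1 (by simp)
  refine ⟨fun Y => ∃ n, Nonempty (Y ≃ₗ[R] LinearMap.ker (Q.d n (n + 1)).hom),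
    ⟨0, ⟨(e ≪≫ e').toLinearEquiv⟩⟩, ?_⟩
  rintro Y ⟨n, ⟨e⟩⟩
  have hx := (range_eq_ker_of_exactAt Q n (n + 1) (n + 1 + 1) (by simp) (by simp)).1 (hQ n)
  have := hP n
  exact ⟨Q.X n, ModuleCat.of R (LinearMap.ker (Q.d (n + 1) (n + 1 + 1)).hom), _, _,
    (Q.X n).projective_of_module_projective,
    (isShortExact_rangeRestrict_ker hx).congr_left e, n + 1, ⟨LinearEquiv.refl _ _⟩⟩

end GorensteinProjectiveClosure

/-! ### Flat dimension through matrices over a right noetherian ring -/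

section MatrixExactness

variable {R : Type u} [Ring R]

/-- A matrix over `R` acting on column vectors with entries in an `R`-module. -/
def matrixAct {a b : ℕ} (D : Matrix (Fin a) (Fin b) R) (W : Type*) [AddCommGroup W] [Module R W] :
    (Fin b → W) →+ (Fin a → W) where
  toFun w i := ∑ j, D i j • w j
  map_zero' := by ext; simp
  map_add' v w := by ext; simp [Finset.sum_add_distrib]

section

variable {W W' : Type*} [AddCommGroup W] [Module R W] [AddCommGroup W'] [Module R W']

theorem matrixAct_apply {a b : ℕ} (D : Matrix (Fin a) (Fin b) R) (w : Fin b → W) (i : Fin a) :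
    matrixAct D W w i = ∑ j, D i j • w j := rfl

theorem matrixAct_matrixAct {a b c : ℕ} (D : Matrix (Fin a) (Fin b) R)
    (D' : Matrix (Fin b) (Fin c) R) (w : Fin c → W) :
    matrixAct D W (matrixAct D' W w) = matrixAct (D * D') W w := by
  ext i
  simp only [matrixAct_apply, Finset.smul_sum, Matrix.mul_apply, Finset.sum_smul, mul_smul]
  exact Finset.sum_comm

theorem matrixAct_comp {a b : ℕ} (D : Matrix (Fin a) (Fin b) R) (f : W →ₗ[R] W') (w : Fin b → W) :
    matrixAct D W' (f ∘ w) = f ∘ matrixAct D W w := by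
  ext i
  simp [matrixAct_apply]

/-- Every column vector over `W` killed by `D` is in the image of `D'`. -/
def MatrixExactOn {a b c : ℕ} (D : Matrix (Fin a) (Fin b) R) (D' : Matrix (Fin b) (Fin c) R)
    (W : Type*) [AddCommGroup W] [Module R W] : Prop :=
  ∀ w : Fin b → W, matrixAct D W w = 0 → ∃ v, matrixAct D' W v = w

/-- The columns of `D'` generate the right module of column vectors killed by `D`. -/
def IsExactMatrixPair {a b c : ℕ} (D : Matrix (Fin a) (Fin b) R) (D' : Matrix (Fin b) (Fin c) R) :
    Prop :=
  D * D' = 0 ∧ MatrixExactOn D D' R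

/-- Embedding P as a summand of a free module reduces the claim to R, one coordinate at a time. The
solutions assemble to finitely supported vectors because they may be taken to be zero outside the
finite set `U` of coordinates that occur in w. -/
theorem IsExactMatrixPair.exactOn_of_projective {a b c : ℕ} {D : Matrix (Fin a) (Fin b) R}
    {D' : Matrix (Fin b) (Fin c) R} (h : IsExactMatrixPair D D') (P : Type*) [AddCommGroup P]
    [Module R P] [Module.Projective R P] : MatrixExactOn D D' P := by
  intro w hw
  obtain ⟨s, hs⟩ := Module.projective_def'.1 (inferInstance : Module.Projective R P)
  have hs' : ∀ p, Finsupp.linearCombination R id (s p) = p := LinearMap.congr_fun hs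
  have hx : ∀ x : P, ∃ v : Fin c → R, matrixAct D' R v = fun j => s (w j) x := by
    intro x
    refine h.2 _ ?_
    have h1 : matrixAct D R ((Finsupp.lapply x ∘ₗ s : P →ₗ[R] R) ∘ w) = 0 := by
      rw [matrixAct_comp, hw]
      ext
      simp
    exact h1
  choose V hV using hx
  classical
  let U : Finset P := Finset.univ.biUnion fun j => (s (w j)).support
  let v : Fin c → (P →₀ R) := fun l => Finsupp.onFinset U (fun x => if x ∈ U then V x l else 0)
    (fun x hx => by by_contra h; simp [h] at hx)
  refine ⟨Finsupp.linearCombination R id ∘ v, ?_⟩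
  rw [matrixAct_comp]
  have : matrixAct D' (P →₀ R) v = s ∘ w := by
    ext j x
    have h2 := congrFun (hV x) j
    simp only [matrixAct_apply, Finsupp.coe_finsetSum, Finset.sum_apply, Finsupp.smul_apply,
      Function.comp_apply] at h2 ⊢
    by_cases hxU : x ∈ U
    · simpa [v, hxU] using h2
    · have h3 : s (w j) x = 0 := by
        by_contra hne
        exact hxU (Finset.mem_biUnion.2 ⟨j, Finset.mem_univ j, Finsupp.mem_support_iff.2 hne⟩)
      simp [v, hxU, h3]
  rw [this]
  ext j
  simp [hs']

end

/-- `D` is the `(m + 1)`-st map in a free resolution of right modules in which `D'` comes next. -/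
def IsIteratedMatrixPair : ℕ → ∀ {a b c : ℕ}, Matrix (Fin a) (Fin b) R →
    Matrix (Fin b) (Fin c) R → Prop
  | 0, _, _, _, D, D' => IsExactMatrixPair D D'
  | m + 1, a, _, _, D, D' => IsExactMatrixPair D D' ∧
      ∃ (z : ℕ) (D₀ : Matrix (Fin z) (Fin a) R), IsIteratedMatrixPair m D₀ D

theorem IsIteratedMatrixPair.isExactMatrixPair {m a b c : ℕ} {D : Matrix (Fin a) (Fin b) R}
    {D' : Matrix (Fin b) (Fin c) R} (h : IsIteratedMatrixPair m D D') : IsExactMatrixPair D D' := by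
  cases m with
  | zero => exact h
  | succ m => exact h.1

/-- `W` has flat dimension at most `m`, in terms of the vanishing of `Tor` with finitely
presented right modules. -/
def HasMatrixFlatDimensionLE (W : Type u) [AddCommGroup W] [Module R W] (m : ℕ) : Prop :=
  ∀ ⦃a b c : ℕ⦄ (D : Matrix (Fin a) (Fin b) R) (D' : Matrix (Fin b) (Fin c) R),
    IsIteratedMatrixPair m D D' → MatrixExactOn D D' W

theorem hasMatrixFlatDimensionLE_of_projective (P : Type u) [AddCommGroup P] [Module R P]
    [Module.Projective R P] (m : ℕ) : HasMatrixFlatDimensionLE (R := R) P m :=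
  fun _ _ _ _ _ h => h.isExactMatrixPair.exactOn_of_projective P

/-- Column vectors as a right module. -/
def columnMap {a b : ℕ} (D : Matrix (Fin a) (Fin b) R) : (Fin b → R) →ₗ[Rᵐᵒᵖ] (Fin a → R) where
  toFun := matrixAct D R
  map_add' := map_add _
  map_smul' r x := by
    ext i
    simp [matrixAct_apply, Finset.sum_mul, mul_assoc]

/-- The regular right module, as a left module over the opposite ring. -/
def regularRightEquiv (R : Type u) [Ring R] : R ≃ₗ[Rᵐᵒᵖ] Rᵐᵒᵖ where
  __ := MulOpposite.opAddEquiv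
  map_smul' r x := by
    induction r using MulOpposite.rec'
    rfl

theorem exists_isExactMatrixPair [IsNoetherianRing Rᵐᵒᵖ] {a b : ℕ} (D : Matrix (Fin a) (Fin b) R) :
    ∃ (c : ℕ) (D' : Matrix (Fin b) (Fin c) R), IsExactMatrixPair D D' := by
  have : IsNoetherian Rᵐᵒᵖ R := isNoetherian_of_linearEquiv (regularRightEquiv R).symm
  obtain ⟨c, s, hs⟩ := Submodule.fg_iff_exists_fin_generating_family.1
    (IsNoetherian.noetherian (LinearMap.ker (columnMap D)))
  refine ⟨c, Matrix.of fun i j => s j i, ?_, ?_⟩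
  · ext i j
    have : s j ∈ LinearMap.ker (columnMap D) := hs ▸ Submodule.subset_span ⟨j, rfl⟩
    exact congrFun (LinearMap.mem_ker.1 this) i
  · intro w hw
    have : w ∈ LinearMap.ker (columnMap D) := hw
    rw [← hs, Submodule.mem_span_range_iff_exists_fun] at this
    obtain ⟨t, rfl⟩ := this
    refine ⟨fun j => (t j).unop, ?_⟩
    ext i
    simp [matrixAct_apply]

section

variable {A P X : Type u} [AddCommGroup A] [Module R A] [AddCommGroup P] [Module R P]
  [AddCommGroup X] [Module R X] {f : A →ₗ[R] P} {g : P →ₗ[R] X}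

/-- This is the connecting map of Tor by hand: a solution p in P has image in X killed by D', and
subtracting a lift of its preimage under D'' moves p into A. -/
theorem IsShortExact.matrixExactOn (h : IsShortExact f g) {a b c d : ℕ}
    {D : Matrix (Fin a) (Fin b) R} {D' : Matrix (Fin b) (Fin c) R} {D'' : Matrix (Fin c) (Fin d) R}
    (hP : MatrixExactOn D D' P) (hD : D' * D'' = 0) (hX : MatrixExactOn D' D'' X) :
    MatrixExactOn D D' A := by
  intro w hw
  obtain ⟨p, hp⟩ := hP (f ∘ w) (by rw [matrixAct_comp, hw]; ext; simp)
  obtain ⟨q, hq⟩ := hX (g ∘ p) (by rw [matrixAct_comp, hp]; ext; simp [h.apply_apply])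
  choose q' hq' using fun j => h.surj (q j)
  have h1 : ∀ j, g (p j - matrixAct D'' P q' j) = 0 := by
    intro j
    have h2 : g ∘ matrixAct D'' P q' = g ∘ p := by
      rw [← matrixAct_comp, ← hq]
      congr 1
      ext j
      exact hq' j
    have := congrFun h2 j
    simp only [Function.comp_apply] at this
    rw [map_sub, this, sub_self]
  choose v hv using fun j => (h.exact _).1 (h1 j)
  refine ⟨v, ?_⟩
  have h3 : f ∘ matrixAct D' A v = f ∘ w := by
    rw [← matrixAct_comp]
    have : f ∘ v = p - matrixAct D'' P q' := funext hv
    rw [this, map_sub, matrixAct_matrixAct, hD, hp]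
    have : matrixAct (0 : Matrix (Fin b) (Fin d) R) P q' = 0 := by
      ext
      simp [matrixAct_apply]
    rw [this, sub_zero]
  ext j
  exact h.inj (congrFun h3 j)

theorem IsShortExact.hasMatrixFlatDimensionLE [IsNoetherianRing Rᵐᵒᵖ] [Module.Projective R P]
    (h : IsShortExact f g) {m : ℕ} (hX : HasMatrixFlatDimensionLE (R := R) X (m + 1)) :
    HasMatrixFlatDimensionLE (R := R) A m := by
  intro a b c D D' hD
  obtain ⟨d, D'', hD'⟩ := exists_isExactMatrixPair D'
  exact h.matrixExactOn (hD.isExactMatrixPair.exactOn_of_projective P) hD'.1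
    (hX D' D'' ⟨hD', a, D, hD⟩)

theorem IsShortExact.hasMatrixFlatDimensionLE_zero [IsNoetherianRing Rᵐᵒᵖ] [Module.Projective R P]
    (h : IsShortExact f g) (hX : HasMatrixFlatDimensionLE (R := R) X 0) :
    HasMatrixFlatDimensionLE (R := R) A 0 := by
  intro a b c D D' hD
  obtain ⟨d, D'', hD'⟩ := exists_isExactMatrixPair D'
  exact h.matrixExactOn (hD.isExactMatrixPair.exactOn_of_projective P) hD'.1 (hX D' D'' hD')

end

/-- The cokernel of D is an m-th syzygy of right modules, so its Ext into R in degree i + 1 vanishes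
as soon as degree i + 1 + m is beyond the right self-injective dimension. -/
theorem IsIteratedMatrixPair.extVanishes {n : ℕ}
    (hn : ∀ (T : ModuleCat.{u} Rᵐᵒᵖ) (i : ℕ), n ≤ i → ExtVanishes Rᵐᵒᵖ T R (i + 1)) {m a b c : ℕ}
    {D : Matrix (Fin a) (Fin b) R} {D' : Matrix (Fin b) (Fin c) R}
    (h : IsIteratedMatrixPair m D D') (i : ℕ) (hi : n ≤ i + m) :
    ExtVanishes Rᵐᵒᵖ ((Fin a → R) ⧸ LinearMap.range (columnMap D)) R (i + 1) := by
  induction m generalizing a b c i with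
  | zero => exact hn (ModuleCat.of Rᵐᵒᵖ _) i hi
  | succ m ih =>
    obtain ⟨-, z, D₀, hD₀⟩ := h
    have hR : Module.Free Rᵐᵒᵖ R := Module.Free.of_equiv (regularRightEquiv R).symm
    have hF : Module.Projective Rᵐᵒᵖ (Fin z → R) := Module.Projective.of_free
    have hx : LinearMap.range (columnMap D) = LinearMap.ker (columnMap D₀) := by
      have h1 := hD₀.isExactMatrixPair
      apply le_antisymm
      · rintro _ ⟨x, rfl⟩
        change matrixAct D₀ R (matrixAct D R x) = 0
        rw [matrixAct_matrixAct, h1.1]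
        ext
        simp [matrixAct_apply]
      · intro x hx
        exact h1.2 x hx
    have hs : IsShortExact
        ((LinearMap.range (columnMap D)).liftQ (columnMap D₀) hx.le)
        (LinearMap.range (columnMap D₀)).mkQ := by
      refine ⟨?_, ?_, Submodule.mkQ_surjective _⟩
      · rw [← LinearMap.ker_eq_bot, Submodule.ker_liftQ_eq_bot']
        exact hx
      · rw [LinearMap.exact_iff, Submodule.range_liftQ, Submodule.ker_mkQ]
    exact hs.extVanishes_left (ExtVanishes.of_projective i) (ih hD₀ (i + 1) (by omega))

/-- Over a ring of finite right self-injective dimension, injective left modules have finite flat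
dimension. -/
theorem hasMatrixFlatDimensionLE_of_injective {n : ℕ}
    (hn : ∀ (T : ModuleCat.{u} Rᵐᵒᵖ) (i : ℕ), n ≤ i → ExtVanishes Rᵐᵒᵖ T R (i + 1))
    (E : Type u) [AddCommGroup E] [Module R E] [Module.Injective R E] :
    HasMatrixFlatDimensionLE (R := R) E n := by
  intro a b c D D' h w hw
  have hext := h.extVanishes hn 0 (by omega)
  have hs : IsShortExact (LinearMap.range (columnMap D)).subtype
      (LinearMap.range (columnMap D)).mkQ :=
    ⟨Subtype.val_injective, by rw [LinearMap.exact_iff]; simp, Submodule.mkQ_surjective _⟩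
  have hextends := hs.extends_of_extVanishes hext
  let φ : (Fin b → R) →ₗ[R] E := Fintype.linearCombination R w
  let ρ : (Fin b → R) →ₗ[R] (Fin c → R) := Matrix.vecMulLinear D'
  have hφ : ∀ r, φ r = ∑ j, r j • w j := fun r => rfl
  have hρ : ∀ r l, ρ r l = ∑ j, r j * D' j l := fun r l => rfl
  -- If r D' = 0, then left multiplication by r kills ker D = im D' and descends to im D. Ext¹(coker
  -- D, R) = 0 extends it to all columns, so r = t D for a row t, and r w = t (D w) = 0.
  have hker : LinearMap.ker ρ ≤ LinearMap.ker φ := by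
    intro r hr
    let θ : (Fin b → R) →ₗ[Rᵐᵒᵖ] R :=
      { toFun := fun x => ∑ j, r j * x j
        map_add' := fun x y => by simp [mul_add, Finset.sum_add_distrib]
        map_smul' := fun s x => by simp [Finset.sum_mul, mul_assoc] }
    have hθ : LinearMap.ker (columnMap D) ≤ LinearMap.ker θ := by
      intro x hx
      obtain ⟨y, rfl⟩ := h.isExactMatrixPair.2 x hx
      have h1 : ∀ l, ∑ j, r j * D' j l = 0 := fun l => congrFun (LinearMap.mem_ker.1 hr) l
      change ∑ j, r j * ∑ l, D' j l * y l = 0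
      simp only [Finset.mul_sum, ← mul_assoc]
      rw [Finset.sum_comm]
      simp [← Finset.sum_mul, h1]
    obtain ⟨t, ht⟩ := hextends ((LinearMap.ker (columnMap D)).liftQ θ hθ ∘ₗ
      (columnMap D).quotKerEquivRange.symm.toLinearMap)
    have ht' : ∀ x, t (columnMap D x) = θ x := by
      intro x
      have := LinearMap.congr_fun ht ⟨columnMap D x, x, rfl⟩
      simp only [LinearMap.comp_apply, Submodule.subtype_apply] at this
      rw [this]
      have h2 : (columnMap D).quotKerEquivRange.symm ⟨columnMap D x, x, rfl⟩ =
          (LinearMap.ker (columnMap D)).mkQ x := by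
        rw [LinearEquiv.symm_apply_eq]
        rfl
      simp [h2]
    have ht'' : ∀ x : Fin a → R, t x = ∑ i, t (Pi.single i 1) * x i := by
      intro x
      conv_lhs => rw [← Finset.univ_sum_single x]
      rw [map_sum]
      refine Finset.sum_congr rfl fun i _ => ?_
      have : Pi.single i (x i) = MulOpposite.op (x i) • (Pi.single i 1 : Fin a → R) := by
        rw [← Pi.single_smul]
        simp
      rw [this, map_smul]
      rfl
    have hr' : ∀ j, r j = ∑ i, t (Pi.single i 1) * D i j := by
      intro j
      have h1 : θ (Pi.single j 1) = r j := by
        change ∑ l, r l * (Pi.single j 1 : Fin b → R) l = r j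
        simp [Pi.single_apply]
      rw [← h1, ← ht', ht'']
      refine Finset.sum_congr rfl fun i _ => ?_
      congr 1
      change ∑ l, D i l * (Pi.single j 1 : Fin b → R) l = D i j
      simp [Pi.single_apply]
    rw [LinearMap.mem_ker, hφ]
    simp only [hr', Finset.sum_smul, mul_smul]
    rw [Finset.sum_comm]
    simp only [← Finset.smul_sum]
    have hw' : ∀ i, ∑ j, D i j • w j = 0 := fun i => congrFun hw i
    simp [hw']
  -- Now r ↦ r w factors through r ↦ r D'. Injectivity of E extends the factor to all rows, and its
  -- values on the standard basis solve D' v = w.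
  obtain ⟨ψ, hψ⟩ := Module.Injective.extension_property R E _ _ (LinearMap.range ρ).subtype
    Subtype.val_injective ((LinearMap.ker ρ).liftQ φ hker ∘ₗ ρ.quotKerEquivRange.symm.toLinearMap)
  have hψ' : ∀ x, ψ (ρ x) = φ x := by
    intro x
    have := LinearMap.congr_fun hψ ⟨ρ x, x, rfl⟩
    simp only [LinearMap.comp_apply, Submodule.subtype_apply] at this
    rw [this]
    have h2 : ρ.quotKerEquivRange.symm ⟨ρ x, x, rfl⟩ = (LinearMap.ker ρ).mkQ x := by
      rw [LinearEquiv.symm_apply_eq]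
      rfl
    simp [h2]
  refine ⟨fun l => ψ (Pi.single l 1), ?_⟩
  ext j
  have h1 : φ (Pi.single j 1) = w j := by simp [hφ, Pi.single_apply]
  rw [← h1, ← hψ', matrixAct_apply]
  have h2 : ρ (Pi.single j 1) = ∑ l, D' j l • Pi.single l 1 := by
    ext l
    simp [hρ, Pi.single_apply]
  rw [h2, map_sum]
  simp

end MatrixExactness

/-! ### Bounds on injective and projective dimension over Iwanaga–Gorenstein rings -/

section HomologicalDimensions

variable {R : Type u} [Ring R]

theorem exists_isShortExact_injective (X : ModuleCat.{u} R) :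
    ∃ (E C : ModuleCat.{u} R) (f : X →ₗ[R] E) (g : E →ₗ[R] C), Module.Injective R E ∧
      IsShortExact f g := by
  let ⟨E, hE, f, hf⟩ := EnoughInjectives.presentation X
  exact ⟨E, ModuleCat.of R (E ⧸ LinearMap.range f.hom), f.hom, _,
    Module.injective_module_of_injective_object R E,
    isShortExact_mkQ ((ModuleCat.mono_iff_injective f).1 hf)⟩

theorem extVanishes_of_le {L : Type u} [AddCommGroup L] [Module R L] {n : ℕ}
    (h : ∀ X : ModuleCat.{u} R, ExtVanishes R X L (n + 1)) (X : ModuleCat.{u} R) (i : ℕ)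
    (hi : n ≤ i) : ExtVanishes R X L (i + 1) := by
  induction i, hi using Nat.le_induction generalizing X with
  | base => exact h X
  | succ i hi ih =>
    obtain ⟨A, f, g, hfg⟩ := exists_isShortExact_free R X
    exact hfg.extVanishes_right (ih A) (ExtVanishes.of_projective _)

theorem extVanishes_of_hasInjectiveDimensionLE {L : Type u} [AddCommGroup L] [Module R L] {n : ℕ}
    (h : HasInjectiveDimensionLE (ModuleCat.of R L) n) (X : ModuleCat.{u} R) (i : ℕ)
    (hi : n ≤ i) : ExtVanishes R X L (i + 1) :=
  HasInjectiveDimensionLT.subsingleton _ (n + 1) (i + 1) (by omega) X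

/-- Baer's criterion in higher degrees. -/
theorem extVanishes_of_ideals {n : ℕ} (F : ModuleCat.{u} R)
    (h : ∀ I : Submodule R R, ExtVanishes R (R ⧸ I) F (n + 1)) (X : ModuleCat.{u} R) :
    ExtVanishes R X F (n + 1) := by
  induction n generalizing F with
  | zero =>
    have hF : Module.Injective R F := Module.Baer.injective fun I a => by
      have hI : IsShortExact I.subtype I.mkQ :=
        ⟨Subtype.val_injective, by rw [LinearMap.exact_iff]; simp, Submodule.mkQ_surjective _⟩
      obtain ⟨b, hb⟩ := hI.extends_of_extVanishes (h I) a
      exact ⟨b, fun x hx => LinearMap.congr_fun hb ⟨x, hx⟩⟩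
    exact ExtVanishes.of_injective 0
  | succ n ih =>
    -- Shifting in the second variable along an embedding into an injective lowers the degree to
    -- that of the usual Baer criterion.
    obtain ⟨E, C, f, g, hE, hfg⟩ := exists_isShortExact_injective F
    have hC : ∀ X : ModuleCat.{u} R, ExtVanishes R X F (n + 1 + 1) → ExtVanishes R X C (n + 1) :=
      fun X hX => hfg.extVanishes_target_right (ExtVanishes.of_injective n) hX
    exact hfg.extVanishes_target_left (ih C fun I => hC (ModuleCat.of R (R ⧸ I)) (h I))
      (ExtVanishes.of_injective _)

/-- A map from a finitely generated module over a noetherian ring to a flat module factors through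
a finite free module. -/
theorem HasMatrixFlatDimensionLE.exists_factor [IsNoetherianRing R] [IsNoetherianRing Rᵐᵒᵖ]
    {F : Type u} [AddCommGroup F] [Module R F] (hF : HasMatrixFlatDimensionLE (R := R) F 0)
    {N : Type u} [AddCommGroup N] [Module R N] [Module.Finite R N] (h : N →ₗ[R] F) :
    ∃ (c : ℕ) (α : N →ₗ[R] (Fin c → R)) (β : (Fin c → R) →ₗ[R] F), β ∘ₗ α = h := by
  obtain ⟨b, π, hπ⟩ := Module.Finite.exists_fin' R N
  obtain ⟨a, s, hs⟩ := Submodule.fg_iff_exists_fin_generating_family.1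
    (IsNoetherian.noetherian (LinearMap.ker π))
  obtain ⟨c, D', hD'⟩ := exists_isExactMatrixPair (Matrix.of s)
  have hs' : ∀ i, π (s i) = 0 := fun i =>
    LinearMap.mem_ker.1 (hs ▸ Submodule.subset_span ⟨i, rfl⟩)
  have hπ' : ∀ r : Fin b → R, h (π r) = ∑ j, r j • h (π (Pi.single j 1)) := by
    intro r
    conv_lhs => rw [← Finset.univ_sum_single r]
    rw [map_sum, map_sum]
    refine Finset.sum_congr rfl fun j _ => ?_
    have : Pi.single j (r j) = r j • (Pi.single j 1 : Fin b → R) := by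
      rw [← Pi.single_smul]
      simp
    rw [this, map_smul, map_smul]
  -- The images of the generators satisfy the relations `s` of N, so flatness writes them as D' v; α
  -- is induced by D' and β by v.
  obtain ⟨v, hv⟩ := hF (Matrix.of s) D' hD' (fun j => h (π (Pi.single j 1))) (by
    ext i
    have := hπ' (s i)
    rw [hs', map_zero] at this
    exact this.symm)
  have hρ : LinearMap.ker π ≤ LinearMap.ker (Matrix.vecMulLinear D' : (Fin b → R) →ₗ[R] _) := by
    rw [← hs, Submodule.span_le]
    rintro _ ⟨i, rfl⟩
    exact congrFun hD'.1 i
  have hπs : IsShortExact (LinearMap.ker π).subtype π := isShortExact_subtype hπ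
  obtain ⟨α, hα⟩ := hπs.exists_desc (Matrix.vecMulLinear D' : (Fin b → R) →ₗ[R] _) (by
    ext x i
    exact congrFun (hρ x.2) i)
  refine ⟨c, α, Fintype.linearCombination R v, ?_⟩
  apply LinearMap.ext
  intro x
  obtain ⟨r, rfl⟩ := hπ x
  have h1 : α (π r) = Matrix.vecMul r D' := LinearMap.congr_fun hα r
  rw [LinearMap.comp_apply, h1, hπ']
  have hv' : ∀ j, ∑ l, D' j l • v l = h (π (Pi.single j 1)) := fun j => congrFun hv j
  simp only [Fintype.linearCombination_apply, Matrix.vecMul, dotProduct, Finset.sum_smul, mul_smul,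
    ← hv', Finset.smul_sum]
  exact Finset.sum_comm

/-- A map to F from the finitely generated syzygy of N factors through some R^c, and each coordinate
extends because Ext¹(N, R) = 0. Higher degrees follow by shifting. -/
theorem HasMatrixFlatDimensionLE.extVanishes_of_finite [IsNoetherianRing R] [IsNoetherianRing Rᵐᵒᵖ]
    {F : Type u} [AddCommGroup F] [Module R F] (hF : HasMatrixFlatDimensionLE (R := R) F 0)
    {i : ℕ} {N : Type u} [AddCommGroup N] [Module R N] [Module.Finite R N]
    (hN : ExtVanishes R N R (i + 1)) : ExtVanishes R N F (i + 1) := by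
  induction i generalizing N with
  | zero =>
    obtain ⟨b, π, hπ⟩ := Module.Finite.exists_fin' R N
    have hs := isShortExact_subtype hπ
    refine hs.extVanishes_one (ExtVanishes.of_projective 0) fun h => ?_
    obtain ⟨c, α, β, rfl⟩ := hF.exists_factor h
    have hR := hs.extends_of_extVanishes hN
    choose γ hγ using fun l : Fin c => hR (LinearMap.proj l ∘ₗ α)
    refine ⟨β ∘ₗ LinearMap.pi γ, ?_⟩
    rw [LinearMap.comp_assoc]
    congr 1
    ext x l
    exact LinearMap.congr_fun (hγ l) x
  | succ i ih =>
    obtain ⟨b, π, hπ⟩ := Module.Finite.exists_fin' R N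
    have hs := isShortExact_subtype hπ
    exact hs.extVanishes_right (ih (hs.extVanishes_left (ExtVanishes.of_projective i) hN))
      (ExtVanishes.of_projective _)

/-- Over a noetherian ring of finite self-injective dimension, flat modules have finite injective
dimension. -/
theorem HasMatrixFlatDimensionLE.extVanishes [IsNoetherianRing R] [IsNoetherianRing Rᵐᵒᵖ] {n : ℕ}
    (hn : ∀ (X : ModuleCat.{u} R) (i : ℕ), n ≤ i → ExtVanishes R X R (i + 1))
    {F : Type u} [AddCommGroup F] [Module R F] (hF : HasMatrixFlatDimensionLE (R := R) F 0)
    (X : ModuleCat.{u} R) (i : ℕ) (hi : n ≤ i) : ExtVanishes R X F (i + 1) :=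
  extVanishes_of_le (fun X => extVanishes_of_ideals (ModuleCat.of R F)
    (fun I => hF.extVanishes_of_finite (hn (ModuleCat.of R (R ⧸ I)) n le_rfl)) X) X i hi

theorem IsShortExact.hasProjectiveDimensionLE_succ {A P X : Type u} [AddCommGroup A] [Module R A]
    [AddCommGroup P] [Module R P] [AddCommGroup X] [Module R X] {f : A →ₗ[R] P} {g : P →ₗ[R] X}
    (h : IsShortExact f g) [Module.Projective R P] (n : ℕ) :
    HasProjectiveDimensionLE (ModuleCat.of R X) (n + 1) ↔
      HasProjectiveDimensionLE (ModuleCat.of R A) n :=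
  h.shortExact.hasProjectiveDimensionLT_X₃_iff n ((IsProjective.iff_projective (R := R) P).1
    inferInstance)

/-- A module of finite flat dimension that is orthogonal to flat modules in high degrees has finite
projective dimension. -/
theorem HasMatrixFlatDimensionLE.hasProjectiveDimensionLE [IsNoetherianRing Rᵐᵒᵖ] {n : ℕ}
    {W : ModuleCat.{u} R} (hW : HasMatrixFlatDimensionLE (R := R) W n)
    (hF : ∀ F : ModuleCat.{u} R, HasMatrixFlatDimensionLE (R := R) F 0 → ∀ i, n ≤ i →
      ExtVanishes R W F (i + 1)) : HasProjectiveDimensionLE W n := by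
  induction n generalizing W with
  | zero =>
    -- The kernel of a free cover of a flat module is flat, so Ext¹ into it vanishes and the cover
    -- splits.
    obtain ⟨A, f, g, hfg⟩ := exists_isShortExact_free R W
    obtain ⟨r, hr⟩ := hfg.extends_of_extVanishes
      (hF A (hfg.hasMatrixFlatDimensionLE_zero hW) 0 le_rfl) LinearMap.id
    have hr' : ∀ a, r (f a) = a := LinearMap.congr_fun hr
    obtain ⟨s, hs⟩ := hfg.exists_desc (LinearMap.id - f ∘ₗ r) (by
      apply LinearMap.ext
      intro a
      simp [hr'])
    have hsg : g ∘ₗ s = LinearMap.id := by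
      apply LinearMap.ext
      intro w
      obtain ⟨x, rfl⟩ := hfg.surj w
      have : s (g x) = x - f (r x) := LinearMap.congr_fun hs x
      simp [this, hfg.apply_apply]
    have : Module.Projective R W := Module.Projective.of_split s g hsg
    have := W.projective_of_categoryTheory_projective
    exact (projective_iff_hasProjectiveDimensionLE_zero _).1 this
  | succ n ih =>
    obtain ⟨A, f, g, hfg⟩ := exists_isShortExact_free R W
    exact (hfg.hasProjectiveDimensionLE_succ n).2 (ih (hfg.hasMatrixFlatDimensionLE hW)
      fun F hF' i hi => hfg.extVanishes_left (ExtVanishes.of_projective i)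
        (hF F hF' (i + 1) (by omega)))

/-- Over an Iwanaga–Gorenstein ring, projective modules have bounded injective dimension and
injective modules have bounded projective dimension. -/
theorem IsIwanagaGorenstein.exists_bound (h : IsIwanagaGorenstein R) :
    ∃ n : ℕ, (∀ X L : ModuleCat.{u} R, Module.Projective R L → ∀ i, n ≤ i →
        ExtVanishes R X L (i + 1)) ∧
      ∀ E : ModuleCat.{u} R, Module.Injective R E → HasProjectiveDimensionLE E n := by
  obtain ⟨hl, hr, ⟨n, hn⟩, ⟨m, hm⟩⟩ := h
  have hF : ∀ F : ModuleCat.{u} R, HasMatrixFlatDimensionLE (R := R) F 0 → ∀ X : ModuleCat.{u} R,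
      ∀ i, max n m ≤ i → ExtVanishes R X F (i + 1) := fun F hF X i hi =>
    hF.extVanishes (extVanishes_of_hasInjectiveDimensionLE hn) X i (le_of_max_le_left hi)
  refine ⟨max n m, fun X L hL i hi => hF L (hasMatrixFlatDimensionLE_of_projective L 0) X i hi,
    fun E hE => ?_⟩
  exact (hasMatrixFlatDimensionLE_of_injective
    (fun T i hi => extVanishes_of_hasInjectiveDimensionLE hm T i (le_of_max_le_right hi)) E).hasProjectiveDimensionLE
    fun F hF' i hi => hF F hF' E i hi

end HomologicalDimensions

/-! ### Gorenstein projective covers over Iwanaga–Gorenstein rings -/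

section IwanagaGorenstein

variable {R : Type u} [Ring R]

/-- Over an Iwanaga–Gorenstein ring, infinite syzygies are Gorenstein projective. -/
theorem isGorensteinProjective_of_isInfiniteSyzygy {n : ℕ}
    (hn : ∀ X L : ModuleCat.{u} R, Module.Projective R L → ∀ i, n ≤ i → ExtVanishes R X L (i + 1))
    (S : ModuleCat.{u} R → Prop) (hS : ∀ X, S X → HasCosyzygyIn S X) {X : ModuleCat.{u} R}
    (hX : S X) : IsGorensteinProjective X := by
  refine isGorensteinProjective_of_hasCosyzygyIn S (fun X hX L hL => ?_) hS hX
  -- Each cosyzygy raises the Ext degree by one, so after n of them the bound `hn` applies.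
  have key : ∀ (k : ℕ) (X : ModuleCat.{u} R), S X → ∀ i, n ≤ i + k → ExtVanishes R X L (i + 1) := by
    intro k
    induction k with
    | zero => exact fun X _ i hi => hn X L hL i hi
    | succ k ih =>
      intro X hX i hi
      obtain ⟨P, B, f, g, hP, hfg, hB⟩ := hS X hX
      exact hfg.extVanishes_left (ExtVanishes.of_projective i) (ih B hB (i + 1) (by omega))
  exact fun i => key n X hX i (by omega)

/-- A class of modules that is closed under cokernels of suitable embeddings into modules of
projective dimension at most `m`. -/
def IsCoresolvingClass (m : ℕ) (S : ModuleCat.{u} R → Prop) : Prop :=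
  ∀ X, S X → ∃ (H B : ModuleCat.{u} R) (f : X →ₗ[R] H) (g : H →ₗ[R] B),
    HasProjectiveDimensionLE H m ∧ IsShortExact f g ∧ S B

/-- The horseshoe lemma: syzygies of the members of a short exact sequence. -/
theorem IsShortExact.exists_horseshoe {X H B K P K' P' : Type u} [AddCommGroup X] [Module R X]
    [AddCommGroup H] [Module R H] [AddCommGroup B] [Module R B] [AddCommGroup K] [Module R K]
    [AddCommGroup P] [Module R P] [AddCommGroup K'] [Module R K'] [AddCommGroup P'] [Module R P']
    {f : X →ₗ[R] H} {g : H →ₗ[R] B} (h : IsShortExact f g) {i : K →ₗ[R] P} {p : P →ₗ[R] X}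
    (hip : IsShortExact i p) {i' : K' →ₗ[R] P'} {p' : P' →ₗ[R] B} (hip' : IsShortExact i' p')
    [Module.Projective R P'] :
    ∃ (N : ModuleCat.{u} R) (j : N →ₗ[R] P × P') (q : P × P' →ₗ[R] H) (a : K →ₗ[R] N)
      (b : N →ₗ[R] K'), IsShortExact j q ∧ IsShortExact a b := by
  obtain ⟨t, ht⟩ := Module.projective_lifting_property g p' h.surj
  have ht' : ∀ x, g (t x) = p' x := LinearMap.congr_fun ht
  let q : P × P' →ₗ[R] H := LinearMap.coprod (f ∘ₗ p) t
  have hq : Function.Surjective q := by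
    intro y
    obtain ⟨x', hx'⟩ := hip'.surj (g y)
    obtain ⟨x, hx⟩ := (h.exact (y - t x')).1 (by rw [map_sub, ht', hx', sub_self])
    obtain ⟨z, rfl⟩ := hip.surj x
    exact ⟨(z, x'), by simp [q, hx]⟩
  have hgq : ∀ x, g (q x) = p' x.2 := by
    rintro ⟨x, x'⟩
    simp [q, h.apply_apply, ht']
  obtain ⟨b, hb⟩ := hip'.exists_lift (LinearMap.snd R P P' ∘ₗ (LinearMap.ker q).subtype) (by
    apply LinearMap.ext
    intro x
    have := hgq x.1
    rw [LinearMap.mem_ker.1 x.2, map_zero] at this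
    exact this.symm)
  have hb' : ∀ x, i' (b x) = x.1.2 := LinearMap.congr_fun hb
  let a : K →ₗ[R] LinearMap.ker q := (LinearMap.inl R P P' ∘ₗ i).codRestrict _ (by
    intro x
    simp [q, hip.apply_apply])
  refine ⟨ModuleCat.of R (LinearMap.ker q), _, q, a, b, isShortExact_subtype hq, ?_, ?_, ?_⟩
  · intro x y hxy
    exact hip.inj (congrArg (fun z => z.1.1) hxy)
  · rintro ⟨⟨x, x'⟩, hx⟩
    constructor
    · intro hbx
      have h0 : x' = 0 := by
        have := hb' ⟨⟨x, x'⟩, hx⟩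
        rw [hbx, map_zero] at this
        exact this.symm
      subst h0
      have h1 : f (p x) = 0 := by simpa [q] using hx
      have h2 : p x = 0 := h.inj (by rw [h1, map_zero])
      obtain ⟨y, rfl⟩ := (hip.exact x).1 h2
      exact ⟨y, rfl⟩
    · rintro ⟨y, hy⟩
      apply hip'.inj
      rw [hb', ← hy, map_zero]
      rfl
  · intro y
    obtain ⟨x, hx⟩ := (h.exact (t (i' y))).1 (by rw [ht', hip'.apply_apply])
    obtain ⟨z, rfl⟩ := hip.surj x
    refine ⟨⟨(-z, i' y), by simp [q, hx]⟩, ?_⟩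
    apply hip'.inj
    rw [hb']

/-- The horseshoe lemma makes the middle term of the syzygy sequence a syzygy of H, which costs one
in projective dimension. -/
theorem IsCoresolvingClass.syzygies {m : ℕ} {S : ModuleCat.{u} R → Prop}
    (hS : IsCoresolvingClass (m + 1) S) :
    IsCoresolvingClass m fun K : ModuleCat.{u} R => ∃ (P X : ModuleCat.{u} R) (i : K →ₗ[R] P) (p : P →ₗ[R] X),
      Module.Projective R P ∧ IsShortExact i p ∧ S X := by
  rintro K ⟨P, X, i, p, hP, hip, hX⟩
  obtain ⟨H, B, f, g, hH, hfg, hB⟩ := hS X hX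
  obtain ⟨K', i', p', hip'⟩ := exists_isShortExact_free R B
  obtain ⟨N, j, q, a, b, hjq, hab⟩ := hfg.exists_horseshoe hip hip'
  exact ⟨N, K', a, b, (hjq.hasProjectiveDimensionLE_succ m).1 hH, hab,
    ModuleCat.of R (B →₀ R), B, i', p', inferInstanceAs (Module.Projective R (B →₀ R)), hip', hB⟩

/-- `X` is a quotient of a Gorenstein projective module by a module of finite projective
dimension. -/
def HasGorensteinProjectiveCover (X : ModuleCat.{u} R) : Prop :=
  ∃ (Y G : ModuleCat.{u} R) (f : Y →ₗ[R] G) (g : G →ₗ[R] X), HasFiniteProjectiveDimension Y ∧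
    IsGorensteinProjective G ∧ IsShortExact f g

/-- Given 0 → Y → G → K → 0, embed G into a projective Q with Gorenstein projective cokernel. The
pushout T of Q and P under G is Gorenstein projective, since maps from G to projectives extend
already to Q. It maps onto X with kernel Q / Y, whose projective dimension exceeds that of Y by at
most one. -/
theorem HasGorensteinProjectiveCover.of_syzygy {K P X : ModuleCat.{u} R}
    (hK : HasGorensteinProjectiveCover K) {i : K →ₗ[R] P} {p : P →ₗ[R] X}
    (hip : IsShortExact i p) (hP : Module.Projective R P) : HasGorensteinProjectiveCover X := by
  obtain ⟨Y, G, f, g, ⟨n, hY⟩, hG, hfg⟩ := hK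
  obtain ⟨Q, G', a, b, hQ, hab, hG'⟩ := hG.hasCosyzygyIn
  let j : G →ₗ[R] Q × P := LinearMap.prod a (i ∘ₗ g)
  have hj : Function.Injective j := fun x y hxy => hab.inj (congrArg Prod.fst hxy)
  have hT := isShortExact_mkQ (R := R) hj
  set c := (LinearMap.range j).mkQ
  have hGT : IsGorensteinProjective (ModuleCat.of R ((Q × P) ⧸ LinearMap.range j)) := by
    refine hG.of_cosyzygy (P := ModuleCat.of R (Q × P)) hT
      (inferInstanceAs (Module.Projective R (Q × P))) fun L hL h => ?_
    obtain ⟨h', rfl⟩ := hab.extends_of_extVanishes (hG'.isExtOrthogonal L hL 0) h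
    exact ⟨h' ∘ₗ LinearMap.fst R Q P, rfl⟩
  obtain ⟨π, hπ⟩ := hT.exists_desc (p ∘ₗ LinearMap.snd R Q P) (by
    apply LinearMap.ext
    intro x
    simp [j, hip.apply_apply])
  have hπ' : ∀ x, π (c x) = p x.2 := LinearMap.congr_fun hπ
  have hπs : Function.Surjective π := by
    intro x
    obtain ⟨y, rfl⟩ := hip.surj x
    exact ⟨c (0, y), hπ' _⟩
  let e : Q →ₗ[R] LinearMap.ker π := (c ∘ₗ LinearMap.inl R Q P).codRestrict _ (by
    intro x
    simp [hπ'])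
  have he : IsShortExact (a ∘ₗ f) e := by
    refine ⟨hab.inj.comp hfg.inj, ?_, ?_⟩
    · intro x
      constructor
      · intro hx
        have h1 : c (x, 0) = 0 := congrArg Subtype.val hx
        obtain ⟨y, hy⟩ := (hT.exact _).1 h1
        have h2 : a y = x := congrArg Prod.fst hy
        have h3 : i (g y) = 0 := congrArg Prod.snd hy
        obtain ⟨z, rfl⟩ := (hfg.exact y).1 (hip.inj (by rw [h3, map_zero]))
        exact ⟨z, h2⟩
      · rintro ⟨y, rfl⟩
        apply Subtype.ext
        have h1 := hT.apply_apply (f y)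
        have h2 : j (f y) = (a (f y), 0) := by simp [j, hfg.apply_apply]
        rw [h2] at h1
        exact h1
    · rintro ⟨x, hx⟩
      obtain ⟨⟨y, z⟩, rfl⟩ := hT.surj x
      obtain ⟨w, rfl⟩ := (hip.exact z).1 ((hπ' _).symm.trans hx)
      obtain ⟨v, rfl⟩ := hfg.surj w
      refine ⟨y - a v, Subtype.ext ?_⟩
      change c (y - a v, 0) = c (y, i (g v))
      rw [← sub_eq_zero, ← map_sub]
      have : ((y - a v, 0) - (y, i (g v)) : Q × P) = j (-v) := by
        simp [j]
      rw [this]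
      exact hT.apply_apply _
  exact ⟨ModuleCat.of R (LinearMap.ker π), _, _, π,
    ⟨n + 1, (he.hasProjectiveDimensionLE_succ n).2 hY⟩, hGT, isShortExact_subtype hπs⟩

/-- Induction on m: for m = 0 the class consists of infinite syzygies, which are their own covers;
otherwise the cover of a syzygy is pushed up to X. -/
theorem IsCoresolvingClass.hasGorensteinProjectiveCover {n : ℕ}
    (hn : ∀ X L : ModuleCat.{u} R, Module.Projective R L → ∀ i, n ≤ i → ExtVanishes R X L (i + 1))
    {m : ℕ} {S : ModuleCat.{u} R → Prop} (hS : IsCoresolvingClass m S) {X : ModuleCat.{u} R}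
    (hX : S X) : HasGorensteinProjectiveCover X := by
  induction m generalizing S X with
  | zero =>
    have hG : IsGorensteinProjective X := isGorensteinProjective_of_isInfiniteSyzygy hn S
      (fun X hX => by
        obtain ⟨H, B, f, g, hH, hfg, hB⟩ := hS X hX
        have := (projective_iff_hasProjectiveDimensionLE_zero _).2 hH
        exact ⟨H, B, f, g, H.projective_of_module_projective, hfg, hB⟩) hX
    have h0 : Module.Projective R (ModuleCat.of R PUnit.{u + 1}) :=
      inferInstanceAs (Module.Projective R PUnit.{u + 1})
    refine ⟨ModuleCat.of R PUnit.{u + 1}, X, 0, LinearMap.id, ⟨0, ?_⟩, hG,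
      fun x y _ => Subsingleton.elim (α := PUnit.{u + 1}) x y, ?_, Function.surjective_id⟩
    · rw [← projective_iff_hasProjectiveDimensionLE_zero]
      exact ModuleCat.projective_of_categoryTheory_projective _
    · intro x
      constructor
      · rintro rfl
        exact ⟨0, rfl⟩
      · rintro ⟨_, rfl⟩
        rfl
  | succ m ih =>
    obtain ⟨A, f, g, hfg⟩ := exists_isShortExact_free R X
    have hF : Module.Projective R (ModuleCat.of R (X →₀ R)) :=
      inferInstanceAs (Module.Projective R (X →₀ R))
    exact (ih hS.syzygies ⟨_, X, f, g, hF, hfg, hX⟩).of_syzygy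
      (P := ModuleCat.of R (X →₀ R)) hfg hF

theorem extVanishes_of_hasProjectiveDimensionLE {X Y : ModuleCat.{u} R} (hX : IsExtOrthogonal X)
    {n : ℕ} (hY : HasProjectiveDimensionLE Y n) (i : ℕ) : ExtVanishes R X Y (i + 1) := by
  induction n generalizing Y i with
  | zero =>
    have := (projective_iff_hasProjectiveDimensionLE_zero _).2 hY
    exact hX Y Y.projective_of_module_projective i
  | succ n ih =>
    obtain ⟨A, f, g, hfg⟩ := exists_isShortExact_free R Y
    exact hfg.extVanishes_target_right (hX (ModuleCat.of R (Y →₀ R))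
      (inferInstanceAs (Module.Projective R (Y →₀ R))) i)
      (ih ((hfg.hasProjectiveDimensionLE_succ n).1 hY) (i + 1))

theorem IsIwanagaGorenstein.isGorensteinProjective_of_isInfiniteSyzygy
    (h : IsIwanagaGorenstein R) {X : ModuleCat.{u} R} (hX : IsInfiniteSyzygy X) :
    IsGorensteinProjective X := by
  obtain ⟨n, hn, -⟩ := h.exists_bound
  obtain ⟨S, hSX, hS⟩ := exists_hasCosyzygyIn_of_isInfiniteSyzygy hX
  exact _root_.isGorensteinProjective_of_isInfiniteSyzygy hn S hS hSX

/-- Embeddings into injectives make the class of all modules coresolving, so X has a Gorenstein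
projective cover with kernel of finite projective dimension. Vanishing of Ext¹ into that kernel
splits the cover. -/
theorem IsIwanagaGorenstein.isGorensteinProjective_iff (h : IsIwanagaGorenstein R)
    (X : ModuleCat.{u} R) : IsGorensteinProjective X ↔ ∀ Y : ModuleCat.{u} R,
      HasFiniteProjectiveDimension Y → Subsingleton (Abelian.Ext X Y 1) := by
  constructor
  · rintro hX Y ⟨n, hY⟩
    exact extVanishes_of_hasProjectiveDimensionLE hX.isExtOrthogonal hY 0
  · intro hX
    obtain ⟨n, hn, hE⟩ := h.exists_bound
    have hS : IsCoresolvingClass n fun _ : ModuleCat.{u} R => True := by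
      intro X _
      obtain ⟨E, C, f, g, hE', hfg⟩ := exists_isShortExact_injective X
      exact ⟨E, C, f, g, hE E hE', hfg, trivial⟩
    obtain ⟨Y, G, f, g, hY, hG, hfg⟩ := hS.hasGorensteinProjectiveCover hn (X := X) trivial
    obtain ⟨r, hr⟩ := hfg.extends_of_extVanishes (hX Y hY) LinearMap.id
    have hr' : ∀ a, r (f a) = a := LinearMap.congr_fun hr
    obtain ⟨s, hs⟩ := hfg.exists_desc (LinearMap.id - f ∘ₗ r) (by
      apply LinearMap.ext
      intro a
      simp [hr'])
    refine hG.of_retract s g ?_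
    apply LinearMap.ext
    intro w
    obtain ⟨x, rfl⟩ := hfg.surj w
    have : s (g x) = x - f (r x) := LinearMap.congr_fun hs x
    simp [this, hfg.apply_apply]

end IwanagaGorenstein

/-! ### The functor Hom_k(Λ₁, k) ⊗_{Λ₁} - -/

section DualTensor

variable {k Λ₁ Λ₂ : Type u} [Field k] [Ring Λ₁] [Algebra k Λ₁] [Ring Λ₂] [Algebra k Λ₂]

/-- The element `φ ⊗ m` of `Hom_k(Λ₁, k) ⊗_{Λ₁} M`. -/
noncomputable def dualTmul {M : ModuleCat.{u} (Λ₁ ⊗[k] Λ₂)} (m : M) (φ : Module.Dual k Λ₁) :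
    dualTensor k Λ₁ Λ₂ M :=
  (dualTensorRel k Λ₁ Λ₂ M).mkQ (TensorProduct.tmul ℤ (M := resRight k Λ₁ Λ₂ M) m φ)

section

variable {M N : ModuleCat.{u} (Λ₁ ⊗[k] Λ₂)}

theorem dualTmul_add_left (m m' : M) (φ : Module.Dual k Λ₁) :
    dualTmul (m + m') φ = dualTmul m φ + dualTmul m' φ :=
  (congrArg (dualTensorRel k Λ₁ Λ₂ M).mkQ
    (TensorProduct.add_tmul (M := resRight k Λ₁ Λ₂ M) m m' φ)).trans (map_add _ _ _)

theorem dualTmul_add_right (m : M) (φ φ' : Module.Dual k Λ₁) :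
    dualTmul m (φ + φ') = dualTmul m φ + dualTmul m φ' :=
  (congrArg (dualTensorRel k Λ₁ Λ₂ M).mkQ
    (TensorProduct.tmul_add (M := resRight k Λ₁ Λ₂ M) m φ φ')).trans (map_add _ _ _)

theorem smul_dualTmul (b : Λ₂) (m : M) (φ : Module.Dual k Λ₁) :
    b • dualTmul m φ = dualTmul (((1 : Λ₁) ⊗ₜ[k] b) • m : M) φ :=
  rfl

theorem dualTmul_smul (a : Λ₁) (m : M) (φ : Module.Dual k Λ₁) :
    dualTmul ((a ⊗ₜ[k] (1 : Λ₂)) • m : M) φ = dualTmul m (φ ∘ₗ LinearMap.mulLeft k a) :=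
  (Submodule.Quotient.eq _).2 (Submodule.subset_span ⟨a, m, φ, rfl⟩)

theorem dualTensor_induction {p : dualTensor k Λ₁ Λ₂ M → Prop} (h0 : p 0)
    (h : ∀ m φ, p (dualTmul m φ)) (hadd : ∀ x y, p x → p y → p (x + y))
    (x : dualTensor k Λ₁ Λ₂ M) : p x := by
  obtain ⟨t, rfl⟩ := (dualTensorRel k Λ₁ Λ₂ M).mkQ_surjective x
  induction t using TensorProduct.induction_on with
  | zero => rw [map_zero]; exact h0
  | tmul m φ => exact h m φ
  | add x y hx hy => rw [map_add]; exact hadd _ _ hx hy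

theorem dualTensor_addHom_ext {V : Type*} [AddCommGroup V] {f g : dualTensor k Λ₁ Λ₂ M →+ V}
    (h : ∀ m φ, f (dualTmul m φ) = g (dualTmul m φ)) : f = g := by
  ext x
  induction x using dualTensor_induction with
  | h0 => simp
  | h m φ => exact h m φ
  | hadd x y hx hy => rw [map_add, map_add, hx, hy]

/-- The universal property of `Hom_k(Λ₁, k) ⊗_{Λ₁} M` as an abelian group. -/
theorem exists_dualTensor_lift {V : Type*} [AddCommGroup V] (β : M → Module.Dual k Λ₁ → V)
    (h₁ : ∀ m m' φ, β (m + m') φ = β m φ + β m' φ) (h₂ : ∀ m φ φ', β m (φ + φ') = β m φ + β m φ')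
    (h : ∀ (a : Λ₁) m φ, β ((a ⊗ₜ[k] (1 : Λ₂)) • m) φ = β m (φ ∘ₗ LinearMap.mulLeft k a)) :
    ∃ g : dualTensor k Λ₁ Λ₂ M →+ V, ∀ m φ, g (dualTmul m φ) = β m φ := by
  let β' : resRight k Λ₁ Λ₂ M →+ Module.Dual k Λ₁ →+ V :=
    AddMonoidHom.mk' (fun m => AddMonoidHom.mk' (β m) (h₂ m)) (fun m m' => by
      ext φ
      exact h₁ m m' φ)
  let g : (resRight k Λ₁ Λ₂ M ⊗[ℤ] Module.Dual k Λ₁) →+ V :=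
    TensorProduct.liftAddHom β' (fun r m φ => by simp)
  have hg : ∀ (m : M) φ, g (TensorProduct.tmul ℤ (M := resRight k Λ₁ Λ₂ M) m φ) = β m φ :=
    fun m φ => rfl
  -- The relations are a Λ₂-span while `g` is only additive, so the induction carries all multiples
  -- `b • x` along.
  have hrel : ∀ x ∈ dualTensorRel k Λ₁ Λ₂ M, ∀ b : Λ₂, g (b • x) = 0 := by
    intro x hx
    induction hx using Submodule.span_induction with
    | mem x hx =>
      obtain ⟨a, m, φ, rfl⟩ := hx
      intro b
      have h1 : b • (TensorProduct.tmul ℤ (M := resRight k Λ₁ Λ₂ M) ((a ⊗ₜ[k] (1 : Λ₂)) • m : M) φ -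
          TensorProduct.tmul ℤ (M := resRight k Λ₁ Λ₂ M) m (φ ∘ₗ LinearMap.mulLeft k a)) =
          TensorProduct.tmul ℤ (M := resRight k Λ₁ Λ₂ M)
            ((a ⊗ₜ[k] (1 : Λ₂)) • ((1 : Λ₁) ⊗ₜ[k] b) • m : M) φ -
          TensorProduct.tmul ℤ (M := resRight k Λ₁ Λ₂ M) (((1 : Λ₁) ⊗ₜ[k] b) • m : M)
            (φ ∘ₗ LinearMap.mulLeft k a) := by
        rw [smul_sub]
        have : (a ⊗ₜ[k] (1 : Λ₂)) • ((1 : Λ₁) ⊗ₜ[k] b) • m =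
            ((1 : Λ₁) ⊗ₜ[k] b) • (a ⊗ₜ[k] (1 : Λ₂)) • m := by
          rw [smul_smul, smul_smul]
          simp
        rw [this]
        rfl
      rw [h1, map_sub, hg, hg, h, sub_self]
    | zero => simp
    | add x y _ _ hx hy => intro b; rw [smul_add, map_add, hx, hy, add_zero]
    | smul c x _ hx => intro b; rw [smul_smul]; exact hx _
  refine ⟨QuotientAddGroup.lift (dualTensorRel k Λ₁ Λ₂ M).toAddSubgroup g fun x hx => ?_,
    fun m φ => rfl⟩
  simpa using hrel x hx 1

/-- The universal property of `Hom_k(Λ₁, k) ⊗_{Λ₁} M` as a `Λ₂`-module. -/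
theorem exists_dualTensor_linear_lift {V : Type*} [AddCommGroup V] [Module Λ₂ V]
    (β : M → Module.Dual k Λ₁ → V)
    (h₁ : ∀ m m' φ, β (m + m') φ = β m φ + β m' φ) (h₂ : ∀ m φ φ', β m (φ + φ') = β m φ + β m φ')
    (h : ∀ (a : Λ₁) m φ, β ((a ⊗ₜ[k] (1 : Λ₂)) • m) φ = β m (φ ∘ₗ LinearMap.mulLeft k a))
    (hb : ∀ (b : Λ₂) m φ, β (((1 : Λ₁) ⊗ₜ[k] b) • m) φ = b • β m φ) :
    ∃ g : dualTensor k Λ₁ Λ₂ M →ₗ[Λ₂] V, ∀ m φ, g (dualTmul m φ) = β m φ := by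
  obtain ⟨g, hg⟩ := exists_dualTensor_lift β h₁ h₂ h
  refine ⟨{ g with map_smul' := fun b x => ?_ }, hg⟩
  change g (b • x) = b • g x
  induction x using dualTensor_induction with
  | h0 => simp
  | h m φ => rw [smul_dualTmul, hg, hg, hb]
  | hadd x y hx hy => rw [smul_add, map_add, map_add, smul_add, hx, hy]

theorem exists_dualTensor_map (f : M →ₗ[Λ₁ ⊗[k] Λ₂] N) :
    ∃ g : dualTensor k Λ₁ Λ₂ M →ₗ[Λ₂] dualTensor k Λ₁ Λ₂ N,
      ∀ m φ, g (dualTmul m φ) = dualTmul (f m) φ :=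
  exists_dualTensor_linear_lift (fun m φ => dualTmul (f m) φ)
    (fun m m' φ => by rw [map_add, dualTmul_add_left]) (fun m => dualTmul_add_right (f m))
    (fun a m φ => by rw [map_smul, dualTmul_smul]) (fun b m φ => by rw [map_smul, smul_dualTmul])

/-- The map `Hom_k(Λ₁, k) ⊗_{Λ₁} M → Hom_k(Λ₁, k) ⊗_{Λ₁} N` induced by `M → N`. -/
noncomputable def dualTensorMap (f : M →ₗ[Λ₁ ⊗[k] Λ₂] N) :
    dualTensor k Λ₁ Λ₂ M →ₗ[Λ₂] dualTensor k Λ₁ Λ₂ N :=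
  (exists_dualTensor_map f).choose

theorem dualTensorMap_dualTmul (f : M →ₗ[Λ₁ ⊗[k] Λ₂] N) (m : M) (φ : Module.Dual k Λ₁) :
    dualTensorMap f (dualTmul m φ) = dualTmul (f m) φ :=
  (exists_dualTensor_map f).choose_spec m φ

theorem dualTensor_linearMap_ext {V : Type*} [AddCommGroup V] [Module Λ₂ V]
    {f g : dualTensor k Λ₁ Λ₂ M →ₗ[Λ₂] V}
    (h : ∀ m φ, f (dualTmul m φ) = g (dualTmul m φ)) : f = g :=
  LinearMap.toAddMonoidHom_injective (dualTensor_addHom_ext h)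

theorem dualTensorMap_surjective {f : M →ₗ[Λ₁ ⊗[k] Λ₂] N} (hf : Function.Surjective f) :
    Function.Surjective (dualTensorMap f) := by
  intro x
  induction x using dualTensor_induction with
  | h0 => exact ⟨0, map_zero _⟩
  | h n φ =>
    obtain ⟨m, rfl⟩ := hf n
    exact ⟨_, dualTensorMap_dualTmul f m φ⟩
  | hadd x y hx hy =>
    obtain ⟨x, rfl⟩ := hx
    obtain ⟨y, rfl⟩ := hy
    exact ⟨x + y, map_add _ _ _⟩

/-- A `Λ₁ ⊗ Λ₂`-linear map as a map of `Λ₁`-modules. -/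
noncomputable def resLeftMap (f : M →ₗ[Λ₁ ⊗[k] Λ₂] N) :
    resLeft k Λ₁ Λ₂ M →ₗ[Λ₁] resLeft k Λ₁ Λ₂ N :=
  ((ModuleCat.restrictScalars
    (Algebra.TensorProduct.includeLeft : Λ₁ →ₐ[k] Λ₁ ⊗[k] Λ₂).toRingHom).map (ModuleCat.ofHom f)).hom

end

section

variable {A P X : ModuleCat.{u} (Λ₁ ⊗[k] Λ₂)} {f : A →ₗ[Λ₁ ⊗[k] Λ₂] P} {g : P →ₗ[Λ₁ ⊗[k] Λ₂] X}

theorem IsShortExact.isShortExact_resLeftMap (h : IsShortExact f g) :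
    IsShortExact (resLeftMap f) (resLeftMap g) :=
  ⟨h.inj, h.exact, h.surj⟩

end

end DualTensor

/-! ### Induced modules Λ₁ ⊗ Y -/

section Induction

variable {k Λ₁ : Type u} [Field k] [Ring Λ₁] [Algebra k Λ₁]

section

variable {Y Y' : Type u} [AddCommGroup Y] [Module k Y] [AddCommGroup Y'] [Module k Y']

/-- The map `Λ₁ ⊗ Y → Y` given by a functional on `Λ₁`. -/
noncomputable def evalTensor (Y : Type u) [AddCommGroup Y] [Module k Y] (φ : Module.Dual k Λ₁) :
    Λ₁ ⊗[k] Y →ₗ[k] Y :=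
  TensorProduct.lid k Y ∘ₗ φ.rTensor Y

@[simp]
theorem evalTensor_tmul (φ : Module.Dual k Λ₁) (a : Λ₁) (y : Y) :
    evalTensor Y φ (a ⊗ₜ y) = φ a • y := by
  simp [evalTensor]

theorem evalTensor_add (φ φ' : Module.Dual k Λ₁) (t : Λ₁ ⊗[k] Y) :
    evalTensor Y (φ + φ') t = evalTensor Y φ t + evalTensor Y φ' t := by
  simp [evalTensor, LinearMap.rTensor_add]

theorem evalTensor_smul (a : Λ₁) (φ : Module.Dual k Λ₁) (t : Λ₁ ⊗[k] Y) :
    evalTensor Y φ (a • t) = evalTensor Y (φ ∘ₗ LinearMap.mulLeft k a) t := by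
  induction t using TensorProduct.induction_on with
  | zero => simp
  | tmul x y => simp [TensorProduct.smul_tmul']
  | add x y hx hy => rw [smul_add, map_add, map_add, hx, hy]

theorem evalTensor_lTensor (f : Y →ₗ[k] Y') (φ : Module.Dual k Λ₁) (t : Λ₁ ⊗[k] Y) :
    evalTensor Y' φ (f.lTensor Λ₁ t) = f (evalTensor Y φ t) := by
  induction t using TensorProduct.induction_on with
  | zero => simp
  | tmul x y => simp
  | add x y hx hy => rw [map_add, map_add, map_add, map_add, hx, hy]

variable [FiniteDimensional k Λ₁]

theorem sum_tmul_evalTensor (t : Λ₁ ⊗[k] Y) :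
    ∑ i, Module.finBasis k Λ₁ i ⊗ₜ[k] evalTensor Y ((Module.finBasis k Λ₁).coord i) t = t := by
  induction t using TensorProduct.induction_on with
  | zero => simp
  | tmul x y =>
    conv_rhs => rw [← (Module.finBasis k Λ₁).sum_repr x, TensorProduct.sum_tmul]
    exact Finset.sum_congr rfl fun i _ => by
      rw [evalTensor_tmul, TensorProduct.smul_tmul, Module.Basis.coord_apply]
  | add x y hx hy => simp only [map_add, TensorProduct.tmul_add, Finset.sum_add_distrib, hx, hy]

theorem evalTensor_ext {t t' : Λ₁ ⊗[k] Y} (h : ∀ φ, evalTensor Y φ t = evalTensor Y φ t') :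
    t = t' := by
  rw [← sum_tmul_evalTensor t, ← sum_tmul_evalTensor t']
  simp only [h]

/-- Together with `evalTensor_ext` this identifies Λ₁ ⊗ Y with Hom_k(D, Y), where D = Hom_k(Λ₁, k);
the preimage of g is the sum of eᵢ ⊗ g(eᵢ*) over a finite basis. -/
theorem exists_evalTensor_eq (g : Module.Dual k Λ₁ →ₗ[k] Y) :
    ∃ t : Λ₁ ⊗[k] Y, ∀ φ, evalTensor Y φ t = g φ := by
  refine ⟨∑ i, Module.finBasis k Λ₁ i ⊗ₜ[k] g ((Module.finBasis k Λ₁).coord i), fun φ => ?_⟩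
  rw [map_sum]
  simp only [evalTensor_tmul, ← map_smul]
  rw [← map_sum]
  congr 1
  refine (Module.finBasis k Λ₁).ext fun j => ?_
  simp

end

variable {Λ₂ : Type u} [Ring Λ₂] [Algebra k Λ₂]

section

/-- The action of `Λ₁ ⊗ Λ₂` on `Λ₁ ⊗ Y` for a `Λ₂`-module `Y`. -/
noncomputable def inducedAction (k Λ₁ Λ₂ Y : Type u) [Field k] [Ring Λ₁] [Algebra k Λ₁] [Ring Λ₂]
    [Algebra k Λ₂] [AddCommGroup Y] [Module k Y] [Module Λ₂ Y] [IsScalarTower k Λ₂ Y] :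
    Λ₁ ⊗[k] Λ₂ →ₐ[k] Module.End k (Λ₁ ⊗[k] Y) :=
  (Module.endTensorEndAlgHom (R := k) (S := k) (A := k) (M := Λ₁) (N := Y)).comp
    (Algebra.TensorProduct.map (Algebra.lmul k Λ₁) (Algebra.lsmul k k Y))

/-- The `Λ₁ ⊗ Λ₂`-module induced from a `Λ₂`-module. -/
@[reducible]
noncomputable def inducedModule (k Λ₁ Λ₂ Y : Type u) [Field k] [Ring Λ₁] [Algebra k Λ₁] [Ring Λ₂]
    [Algebra k Λ₂] [AddCommGroup Y] [Module k Y] [Module Λ₂ Y] [IsScalarTower k Λ₂ Y] :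
    Module (Λ₁ ⊗[k] Λ₂) (Λ₁ ⊗[k] Y) :=
  Module.compHom _ (inducedAction k Λ₁ Λ₂ Y).toRingHom

attribute [local instance] inducedModule

variable {Y Y' : Type u} [AddCommGroup Y] [Module k Y] [Module Λ₂ Y] [IsScalarTower k Λ₂ Y]
  [AddCommGroup Y'] [Module k Y'] [Module Λ₂ Y'] [IsScalarTower k Λ₂ Y']

theorem induced_smul_tmul (a x : Λ₁) (b : Λ₂) (y : Y) :
    (a ⊗ₜ[k] b) • (x ⊗ₜ[k] y) = (a * x) ⊗ₜ[k] (b • y) := by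
  change inducedAction k Λ₁ Λ₂ Y (a ⊗ₜ b) (x ⊗ₜ y) = _
  simp only [inducedAction, AlgHom.comp_apply, Algebra.TensorProduct.map_tmul,
    Module.endTensorEndAlgHom_apply]
  rfl

theorem induced_smul_left (a : Λ₁) (t : Λ₁ ⊗[k] Y) : (a ⊗ₜ[k] (1 : Λ₂)) • t = a • t := by
  induction t using TensorProduct.induction_on with
  | zero => simp
  | tmul x y => rw [induced_smul_tmul, one_smul, TensorProduct.smul_tmul', smul_eq_mul]
  | add x y hx hy => rw [smul_add, smul_add, hx, hy]

theorem evalTensor_smul_right (b : Λ₂) (φ : Module.Dual k Λ₁) (t : Λ₁ ⊗[k] Y) :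
    evalTensor Y φ (((1 : Λ₁) ⊗ₜ[k] b) • t) = b • evalTensor Y φ t := by
  induction t using TensorProduct.induction_on with
  | zero => simp
  | tmul x y => rw [induced_smul_tmul, evalTensor_tmul, evalTensor_tmul, one_mul, smul_comm]
  | add x y hx hy => rw [smul_add, map_add, map_add, smul_add, hx, hy]

theorem tmul_eq_mul (a : Λ₁) (b : Λ₂) : a ⊗ₜ[k] b = (a ⊗ₜ[k] (1 : Λ₂)) * ((1 : Λ₁) ⊗ₜ[k] b) := by
  simp

theorem exists_linearMap_of_tmul {M N : Type*} [AddCommGroup M] [Module (Λ₁ ⊗[k] Λ₂) M]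
    [AddCommGroup N] [Module (Λ₁ ⊗[k] Λ₂) N] (f : M →+ N)
    (h₁ : ∀ (a : Λ₁) x, f ((a ⊗ₜ[k] (1 : Λ₂)) • x) = (a ⊗ₜ[k] (1 : Λ₂)) • f x)
    (h₂ : ∀ (b : Λ₂) x, f (((1 : Λ₁) ⊗ₜ[k] b) • x) = ((1 : Λ₁) ⊗ₜ[k] b) • f x) :
    ∃ g : M →ₗ[Λ₁ ⊗[k] Λ₂] N, ∀ x, g x = f x := by
  refine ⟨{ f with map_smul' := fun r x => ?_ }, fun x => rfl⟩
  change f (r • x) = r • f x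
  induction r using TensorProduct.induction_on with
  | zero => simp
  | tmul a b => rw [tmul_eq_mul, mul_smul, h₁, h₂, mul_smul]
  | add r s hr hs => rw [add_smul, map_add, hr, hs, add_smul]

/-- The functor `Λ₁ ⊗ -` on maps of `Λ₂`-modules. -/
theorem exists_inducedMap (f : Y →ₗ[Λ₂] Y') :
    ∃ g : Λ₁ ⊗[k] Y →ₗ[Λ₁ ⊗[k] Λ₂] Λ₁ ⊗[k] Y',
      ∀ t, g t = (f.restrictScalars k).lTensor Λ₁ t := by
  refine exists_linearMap_of_tmul ((f.restrictScalars k).lTensor Λ₁).toAddMonoidHom ?_ ?_ <;>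
  · intro c t
    induction t using TensorProduct.induction_on with
    | zero => simp
    | tmul x y => simp [induced_smul_tmul]
    | add x y hx hy => rw [smul_add, map_add, map_add, smul_add, hx, hy]

theorem exists_isShortExact_induced {A P X : Type u} [AddCommGroup A] [Module k A] [Module Λ₂ A]
    [IsScalarTower k Λ₂ A] [AddCommGroup P] [Module k P] [Module Λ₂ P] [IsScalarTower k Λ₂ P]
    [AddCommGroup X] [Module k X] [Module Λ₂ X] [IsScalarTower k Λ₂ X] {f : A →ₗ[Λ₂] P}
    {g : P →ₗ[Λ₂] X} (h : IsShortExact f g) :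
    ∃ (f' : Λ₁ ⊗[k] A →ₗ[Λ₁ ⊗[k] Λ₂] Λ₁ ⊗[k] P) (g' : Λ₁ ⊗[k] P →ₗ[Λ₁ ⊗[k] Λ₂] Λ₁ ⊗[k] X),
      IsShortExact f' g' := by
  obtain ⟨f', hf'⟩ := exists_inducedMap (k := k) (Λ₁ := Λ₁) f
  obtain ⟨g', hg'⟩ := exists_inducedMap (k := k) (Λ₁ := Λ₁) g
  have hf : (f' : Λ₁ ⊗[k] A → Λ₁ ⊗[k] P) = (f.restrictScalars k).lTensor Λ₁ := funext hf'
  have hg : (g' : Λ₁ ⊗[k] P → Λ₁ ⊗[k] X) = (g.restrictScalars k).lTensor Λ₁ := funext hg'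
  refine ⟨f', g', ?_, ?_, ?_⟩
  · rw [hf]
    exact Module.Flat.lTensor_preserves_injective_linearMap _ h.inj
  · rw [hf, hg]
    exact lTensor_exact _ h.exact h.surj
  · rw [hg]
    exact LinearMap.lTensor_surjective _ h.surj

theorem exists_inducedModule_lift {Z : Type*} [AddCommGroup Z] [Module (Λ₁ ⊗[k] Λ₂) Z]
    (l : Y →+ Z) (hl : ∀ (b : Λ₂) y, l (b • y) = ((1 : Λ₁) ⊗ₜ[k] b) • l y) :
    ∃ h : Λ₁ ⊗[k] Y →ₗ[Λ₁ ⊗[k] Λ₂] Z, ∀ a y, h (a ⊗ₜ y) = (a ⊗ₜ[k] (1 : Λ₂)) • l y := by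
  let β : Λ₁ →+ Y →+ Z := AddMonoidHom.mk' (fun a => AddMonoidHom.mk'
    (fun y => (a ⊗ₜ[k] (1 : Λ₂)) • l y) (fun y y' => by rw [map_add, smul_add])) (fun a a' => by
      ext y
      simp [TensorProduct.add_tmul, add_smul])
  let f : Λ₁ ⊗[k] Y →+ Z := TensorProduct.liftAddHom β (fun c a y => by
    change ((c • a) ⊗ₜ[k] (1 : Λ₂)) • l y = (a ⊗ₜ[k] (1 : Λ₂)) • l (c • y)
    have : c • y = algebraMap k Λ₂ c • y := by rw [algebraMap_smul]
    rw [this, hl, smul_smul]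
    congr 1
    rw [Algebra.TensorProduct.tmul_mul_tmul, mul_one, one_mul, Algebra.algebraMap_eq_smul_one,
      TensorProduct.smul_tmul])
  have hf : ∀ a y, f (a ⊗ₜ y) = (a ⊗ₜ[k] (1 : Λ₂)) • l y := fun a y => rfl
  obtain ⟨h, hh⟩ := exists_linearMap_of_tmul (k := k) (Λ₁ := Λ₁) (Λ₂ := Λ₂) f
    (fun a t => by
      induction t using TensorProduct.induction_on with
      | zero => simp
      | tmul x y => rw [induced_smul_tmul, hf, hf, one_smul, smul_smul]; simp
      | add x y hx hy => rw [smul_add, map_add, map_add, smul_add, hx, hy])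
    (fun b t => by
      induction t using TensorProduct.induction_on with
      | zero => simp
      | tmul x y => rw [induced_smul_tmul, hf, hf, hl, smul_smul, smul_smul]; simp
      | add x y hx hy => rw [smul_add, map_add, map_add, smul_add, hx, hy])
  exact ⟨h, fun a y => by rw [hh, hf]⟩

/-- Λ₁ ⊗ - is left adjoint to the exact restriction to Λ₂: lift y ↦ 1 ⊗ y over Λ₂, then extend along
Λ₁. -/
theorem projective_inducedModule [Module.Projective Λ₂ Y] :
    Module.Projective (Λ₁ ⊗[k] Λ₂) (Λ₁ ⊗[k] Y) := by
  refine Module.Projective.of_lifting_property'' fun f hf => ?_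
  let Z : ModuleCat.{u} (Λ₁ ⊗[k] Λ₂) := ModuleCat.of _ ((Λ₁ ⊗[k] Y) →₀ (Λ₁ ⊗[k] Λ₂))
  let F : ModuleCat.{u} (Λ₁ ⊗[k] Λ₂) := ModuleCat.of _ (Λ₁ ⊗[k] Y)
  let f' : resRight k Λ₁ Λ₂ Z →ₗ[Λ₂] resRight k Λ₁ Λ₂ F :=
    ((ModuleCat.restrictScalars (Algebra.TensorProduct.includeRight :
      Λ₂ →ₐ[k] Λ₁ ⊗[k] Λ₂).toRingHom).map (ModuleCat.ofHom f)).hom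
  let u : Y →ₗ[Λ₂] resRight k Λ₁ Λ₂ F :=
    { toFun := fun y => ((1 : Λ₁) ⊗ₜ[k] y : Λ₁ ⊗[k] Y)
      map_add' := fun y y' => TensorProduct.tmul_add _ _ _
      map_smul' := fun b y => by
        change (1 : Λ₁) ⊗ₜ[k] (b • y) = ((1 : Λ₁) ⊗ₜ[k] b) • ((1 : Λ₁) ⊗ₜ[k] y)
        rw [induced_smul_tmul, one_mul] }
  obtain ⟨l, hl⟩ := Module.projective_lifting_property f' u hf
  let l' : Y →+ ((Λ₁ ⊗[k] Y) →₀ (Λ₁ ⊗[k] Λ₂)) := l.toAddMonoidHom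
  obtain ⟨h, hh⟩ := exists_inducedModule_lift (k := k) (Λ₁ := Λ₁) (Λ₂ := Λ₂) l'
    fun b y => l.map_smul b y
  refine ⟨h, ?_⟩
  apply LinearMap.ext
  intro t
  induction t using TensorProduct.induction_on with
  | zero => simp
  | tmul a y =>
    have h1 : f (l' y) = (1 : Λ₁) ⊗ₜ[k] y := LinearMap.congr_fun hl y
    rw [LinearMap.comp_apply, hh, map_smul, h1, induced_smul_tmul]
    simp
  | add x y hx hy => rw [map_add, map_add, hx, hy]

/-- Every projective `Λ₁ ⊗ Λ₂`-module is a direct summand of one induced from a free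
`Λ₂`-module. -/
theorem exists_retract_inducedModule (P : ModuleCat.{u} (Λ₁ ⊗[k] Λ₂))
    (hP : Module.Projective (Λ₁ ⊗[k] Λ₂) P) :
    ∃ (s : P →ₗ[Λ₁ ⊗[k] Λ₂] Λ₁ ⊗[k] (P →₀ Λ₂)) (r : Λ₁ ⊗[k] (P →₀ Λ₂) →ₗ[Λ₁ ⊗[k] Λ₂] P),
      r ∘ₗ s = LinearMap.id := by
  let l : (P →₀ Λ₂) →ₗ[Λ₂] resRight k Λ₁ Λ₂ P :=
    Finsupp.linearCombination Λ₂ (M := resRight k Λ₁ Λ₂ P) (fun p : P => p)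
  let l' : (P →₀ Λ₂) →+ P := l.toAddMonoidHom
  have hl' : ∀ p : P, l' (Finsupp.single p 1) = p := fun p =>
    (Finsupp.linearCombination_single Λ₂ (M := resRight k Λ₁ Λ₂ P) (v := fun p : P => p) 1 p).trans
      (one_smul Λ₂ (α := resRight k Λ₁ Λ₂ P) p)
  obtain ⟨r, hr⟩ := exists_inducedModule_lift (k := k) (Λ₁ := Λ₁) (Λ₂ := Λ₂) l'
    fun b y => l.map_smul b y
  have hs : Function.Surjective r := by
    intro p
    refine ⟨1 ⊗ₜ Finsupp.single p 1, ?_⟩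
    rw [hr, hl', ← Algebra.TensorProduct.one_def, one_smul]
  obtain ⟨s, hs⟩ := Module.projective_lifting_property r LinearMap.id hs
  exact ⟨s, r, hs⟩

end

end Induction

/-! ### The adjunction between Hom_k(Λ₁, k) ⊗_{Λ₁} - and Λ₁ ⊗ - -/

section InductionAdjunction

open scoped ModuleCat

variable {k Λ₁ Λ₂ : Type u} [Field k] [Ring Λ₁] [Algebra k Λ₁] [Ring Λ₂] [Algebra k Λ₂]

attribute [local instance] inducedModule

section

variable {M : ModuleCat.{u} (Λ₁ ⊗[k] Λ₂)}

/-- The underlying tensor product is over ℤ, so balance over k is not built in: the scalar crosses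
as an element of Λ₁ and is then moved to Λ₂ inside Λ₁ ⊗ Λ₂. -/
theorem dualTmul_smul_right (c : k) (m : M) (φ : Module.Dual k Λ₁) :
    dualTmul m (c • φ) = c • dualTmul m φ := by
  have h1 : c • φ = φ ∘ₗ LinearMap.mulLeft k (algebraMap k Λ₁ c) := by
    ext x
    simp [← Algebra.smul_def]
  have h2 : (algebraMap k Λ₁ c) ⊗ₜ[k] (1 : Λ₂) = (1 : Λ₁) ⊗ₜ[k] (algebraMap k Λ₂ c) := by
    rw [Algebra.algebraMap_eq_smul_one, Algebra.algebraMap_eq_smul_one, TensorProduct.smul_tmul]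
  rw [h1, ← dualTmul_smul, h2, ← smul_dualTmul, algebraMap_smul]

theorem evalTensor_smul_dual {Y : Type u} [AddCommGroup Y] [Module k Y] (c : k)
    (φ : Module.Dual k Λ₁) (t : Λ₁ ⊗[k] Y) : evalTensor Y (c • φ) t = c • evalTensor Y φ t := by
  simp [evalTensor, LinearMap.rTensor_smul]

variable {V : Type u} [AddCommGroup V] [Module k V]

/-- One half of the adjunction between `Hom_k(Λ₁, k) ⊗_{Λ₁} -` and `Λ₁ ⊗ -`. -/
theorem exists_addHom_tensor_of_dualTensor [FiniteDimensional k Λ₁]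
    (ψ : dualTensor k Λ₁ Λ₂ M →ₗ[k] V) :
    ∃ α : M →+ Λ₁ ⊗[k] V, ∀ m φ, evalTensor V φ (α m) = ψ (dualTmul m φ) := by
  have h : ∀ m : M, ∃ t : Λ₁ ⊗[k] V, ∀ φ, evalTensor V φ t = ψ (dualTmul m φ) := fun m =>
    exists_evalTensor_eq
      { toFun := fun φ => ψ (dualTmul m φ)
        map_add' := fun φ φ' => by rw [dualTmul_add_right, map_add]
        map_smul' := fun c φ => by rw [dualTmul_smul_right, map_smul, RingHom.id_apply] }
  choose α hα using h
  refine ⟨AddMonoidHom.mk' α fun m m' => evalTensor_ext fun φ => ?_, hα⟩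
  rw [map_add, hα, hα, hα, dualTmul_add_left, map_add]

theorem exists_linearMap_tensor_of_dualTensor [FiniteDimensional k Λ₁]
    (ψ : dualTensor k Λ₁ Λ₂ M →ₗ[k] V) :
    ∃ α : resLeft k Λ₁ Λ₂ M →ₗ[Λ₁] Λ₁ ⊗[k] V,
      ∀ (m : M) φ, evalTensor V φ (α m) = ψ (dualTmul m φ) := by
  obtain ⟨α, hα⟩ := exists_addHom_tensor_of_dualTensor ψ
  refine ⟨{ toFun := α, map_add' := map_add α, map_smul' := fun a m => evalTensor_ext fun φ => ?_ },
    hα⟩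
  have key : ∀ m : M, evalTensor V φ (α ((a ⊗ₜ[k] (1 : Λ₂)) • m)) = evalTensor V φ (a • α m) := by
    intro m
    rw [evalTensor_smul, hα, hα, dualTmul_smul]
  exact key m

theorem exists_dualTensor_of_linearMap_tensor
    (α : resLeft k Λ₁ Λ₂ M →ₗ[Λ₁] Λ₁ ⊗[k] V) :
    ∃ ψ : dualTensor k Λ₁ Λ₂ M →ₗ[k] V, ∀ (m : M) φ, ψ (dualTmul m φ) = evalTensor V φ (α m) := by
  obtain ⟨g, hg⟩ := exists_dualTensor_lift (M := M) (fun m φ => evalTensor V φ (α m))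
    (fun m m' φ => (congrArg (evalTensor V φ) (α.map_add m m')).trans (map_add _ _ _))
    (fun m φ φ' => evalTensor_add _ _ _)
    (fun a m φ => (congrArg (evalTensor V φ) (α.map_smul a m)).trans (evalTensor_smul a φ _))
  refine ⟨{ g with map_smul' := fun c x => ?_ }, hg⟩
  change g (c • x) = c • g x
  induction x using dualTensor_induction with
  | h0 => simp
  | h m φ => rw [← dualTmul_smul_right, hg, hg, evalTensor_smul_dual]
  | hadd x y hx hy => rw [smul_add, map_add, map_add, smul_add, hx, hy]

variable {Y : Type u} [AddCommGroup Y] [Module k Y] [Module Λ₂ Y] [IsScalarTower k Λ₂ Y]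

theorem exists_induced_of_dualTensor [FiniteDimensional k Λ₁]
    (ψ : dualTensor k Λ₁ Λ₂ M →ₗ[Λ₂] Y) :
    ∃ α : M →ₗ[Λ₁ ⊗[k] Λ₂] Λ₁ ⊗[k] Y, ∀ m φ, evalTensor Y φ (α m) = ψ (dualTmul m φ) := by
  obtain ⟨α, hα⟩ := exists_addHom_tensor_of_dualTensor (ψ.restrictScalars k)
  obtain ⟨α', hα'⟩ := exists_linearMap_of_tmul (k := k) (Λ₁ := Λ₁) (Λ₂ := Λ₂) α
    (fun a m => evalTensor_ext fun φ => by
      rw [induced_smul_left, evalTensor_smul, hα, hα, dualTmul_smul])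
    (fun b m => evalTensor_ext fun φ => by
      rw [evalTensor_smul_right, hα, hα, ← smul_dualTmul]
      exact ψ.map_smul b _)
  exact ⟨α', fun m φ => by rw [hα', hα]; rfl⟩

theorem exists_dualTensor_of_induced (α : M →ₗ[Λ₁ ⊗[k] Λ₂] Λ₁ ⊗[k] Y) :
    ∃ ψ : dualTensor k Λ₁ Λ₂ M →ₗ[Λ₂] Y, ∀ m φ, ψ (dualTmul m φ) = evalTensor Y φ (α m) :=
  exists_dualTensor_linear_lift (fun m φ => evalTensor Y φ (α m))
    (fun m m' φ => by rw [map_add, map_add]) (fun m φ φ' => evalTensor_add _ _ _)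
    (fun a m φ => by rw [map_smul, induced_smul_left, evalTensor_smul])
    (fun b m φ => by rw [map_smul, evalTensor_smul_right])

end

/-- Every projective module over an algebra is a direct summand of a free one. -/
theorem exists_retract_tensor (L : Type u) [AddCommGroup L] [Module Λ₁ L] [Module k L]
    [IsScalarTower k Λ₁ L] [Module.Projective Λ₁ L] :
    ∃ (s : L →ₗ[Λ₁] Λ₁ ⊗[k] L) (r : Λ₁ ⊗[k] L →ₗ[Λ₁] L), r ∘ₗ s = LinearMap.id := by
  let r : Λ₁ ⊗[k] L →ₗ[Λ₁] L := TensorProduct.AlgebraTensorModule.lift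
    { toFun := fun a => Algebra.lsmul k k L a
      map_add' := fun a b => map_add _ a b
      map_smul' := fun a b => by
        ext x
        simp }
  have hr : Function.Surjective r := fun x => ⟨1 ⊗ₜ x, by simp [r]⟩
  obtain ⟨s, hs⟩ := Module.projective_lifting_property r LinearMap.id hr
  exact ⟨s, r, hs⟩

section

variable [FiniteDimensional k Λ₁] {A P X : ModuleCat.{u} (Λ₁ ⊗[k] Λ₂)}
  {f : A →ₗ[Λ₁ ⊗[k] Λ₂] P} {g : P →ₗ[Λ₁ ⊗[k] Λ₂] X}
  {V : Type u} [AddCommGroup V] [Module k V]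
  {Y : Type u} [AddCommGroup Y] [Module k Y] [Module Λ₂ Y] [IsScalarTower k Λ₂ Y]

theorem extends_induced_iff :
    Extends f (Λ₁ ⊗[k] Y) ↔ Extends (dualTensorMap f) Y := by
  constructor
  · intro h ψ
    obtain ⟨α, hα⟩ := exists_induced_of_dualTensor ψ
    obtain ⟨α', rfl⟩ := h α
    obtain ⟨ψ', hψ'⟩ := exists_dualTensor_of_induced α'
    refine ⟨ψ', dualTensor_linearMap_ext fun m φ => ?_⟩
    rw [← hα, LinearMap.comp_apply, dualTensorMap_dualTmul, hψ', LinearMap.comp_apply]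
  · intro h α
    obtain ⟨ψ, hψ⟩ := exists_dualTensor_of_induced α
    obtain ⟨ψ', rfl⟩ := h ψ
    obtain ⟨α', hα'⟩ := exists_induced_of_dualTensor ψ'
    refine ⟨α', LinearMap.ext fun m => evalTensor_ext fun φ => ?_⟩
    rw [← hψ, LinearMap.comp_apply, hα', LinearMap.comp_apply, dualTensorMap_dualTmul]

theorem Extends.of_retract {R : Type u} [Ring R] {A P L L' : Type*} [AddCommGroup A] [Module R A]
    [AddCommGroup P] [Module R P] [AddCommGroup L] [Module R L] [AddCommGroup L'] [Module R L']
    {f : A →ₗ[R] P} (h : Extends f L) (s : L' →ₗ[R] L) (r : L →ₗ[R] L')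
    (hrs : r ∘ₗ s = LinearMap.id) : Extends f L' := by
  intro a
  obtain ⟨b, hb⟩ := h (s ∘ₗ a)
  refine ⟨r ∘ₗ b, ?_⟩
  rw [LinearMap.comp_assoc, hb, ← LinearMap.comp_assoc, hrs, LinearMap.id_comp]

/-- By adjunction the extension problem is one over the field k, where injective maps split. -/
theorem extends_resLeftMap_of_injective (h : Function.Injective (dualTensorMap f)) :
    Extends (resLeftMap f) (Λ₁ ⊗[k] V) := by
  intro α
  obtain ⟨ψ, hψ⟩ := exists_dualTensor_of_linearMap_tensor α
  obtain ⟨ρ, hρ⟩ := LinearMap.exists_leftInverse_of_injective ((dualTensorMap f).restrictScalars k)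
    (LinearMap.ker_eq_bot.2 h)
  obtain ⟨α', hα'⟩ := exists_linearMap_tensor_of_dualTensor (ψ ∘ₗ ρ)
  refine ⟨α', LinearMap.ext fun m => evalTensor_ext fun φ => ?_⟩
  have key : ∀ m : A, (ψ ∘ₗ ρ) (dualTmul (f m) φ) = ψ (dualTmul m φ) := by
    intro m
    rw [← dualTensorMap_dualTmul]
    exact congrArg ψ (LinearMap.congr_fun hρ (dualTmul m φ))
  exact (hα' (f m) φ).trans ((key m).trans (hψ m φ))

/-- Extending the unit of the adjunction at A produces, by adjunction, a left inverse of
`dualTensorMap f`. -/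
theorem dualTensorMap_injective (h : Extends (resLeftMap f) (Λ₁ ⊗[k] dualTensor k Λ₁ Λ₂ A)) :
    Function.Injective (dualTensorMap f) := by
  obtain ⟨α, hα⟩ := exists_linearMap_tensor_of_dualTensor
    (LinearMap.id : dualTensor k Λ₁ Λ₂ A →ₗ[k] dualTensor k Λ₁ Λ₂ A)
  obtain ⟨α', rfl⟩ := h α
  obtain ⟨ψ, hψ⟩ := exists_dualTensor_of_linearMap_tensor α'
  have key : (ψ.toAddMonoidHom.comp (dualTensorMap f).toAddMonoidHom) = AddMonoidHom.id _ :=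
    dualTensor_addHom_ext fun m φ => by
      change ψ (dualTensorMap f (dualTmul m φ)) = dualTmul m φ
      rw [dualTensorMap_dualTmul, hψ]
      exact hα m φ
  exact Function.LeftInverse.injective (g := ψ) fun x => DFunLike.congr_fun key x

theorem IsShortExact.dualTensorMap_exact (h : IsShortExact f g) :
    Function.Exact (dualTensorMap f) (dualTensorMap g) := by
  intro y
  constructor
  · intro hy
    -- A left adjoint is right exact: the adjoint of the projection to the cokernel vanishes on A,
    -- so the projection factors through `dualTensorMap g`.
    let Q := dualTensor k Λ₁ Λ₂ P ⧸ LinearMap.range (dualTensorMap f)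
    let ψ : dualTensor k Λ₁ Λ₂ P →ₗ[Λ₂] ModuleCat.of Λ₂ Q :=
      (LinearMap.range (dualTensorMap f)).mkQ
    obtain ⟨α, hα⟩ := exists_induced_of_dualTensor ψ
    obtain ⟨α', rfl⟩ := h.exists_desc α (LinearMap.ext fun m => evalTensor_ext fun φ => by
      rw [LinearMap.comp_apply, hα, ← dualTensorMap_dualTmul, LinearMap.zero_apply, map_zero]
      exact (Submodule.Quotient.mk_eq_zero _).2 ⟨_, rfl⟩)
    obtain ⟨ψ', hψ'⟩ := exists_dualTensor_of_induced α'
    have key : ψ' ∘ₗ dualTensorMap g = ψ := dualTensor_linearMap_ext fun m φ => by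
      rw [LinearMap.comp_apply, dualTensorMap_dualTmul, hψ', ← hα, LinearMap.comp_apply]
    have : ψ y = 0 := by rw [← key, LinearMap.comp_apply, hy, map_zero]
    exact (Submodule.Quotient.mk_eq_zero _).1 this
  · rintro ⟨x, rfl⟩
    have : dualTensorMap g ∘ₗ dualTensorMap f = 0 := dualTensor_linearMap_ext fun m φ => by
      rw [LinearMap.comp_apply, dualTensorMap_dualTmul, dualTensorMap_dualTmul, h.apply_apply,
        LinearMap.zero_apply]
      have := dualTmul_add_left (0 : X) 0 φ
      rw [add_zero] at this
      exact left_eq_add.1 this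
    exact LinearMap.congr_fun this x

theorem IsShortExact.isShortExact_dualTensorMap (h : IsShortExact f g)
    (hf : Function.Injective (dualTensorMap f)) :
    IsShortExact (dualTensorMap f) (dualTensorMap g) :=
  ⟨hf, h.dualTensorMap_exact, dualTensorMap_surjective h.surj⟩

/-- The right adjoint Λ₁ ⊗ - preserves surjections, so its left adjoint preserves projectives. -/
theorem projective_dualTensor (P : ModuleCat.{u} (Λ₁ ⊗[k] Λ₂))
    (hP : Module.Projective (Λ₁ ⊗[k] Λ₂) P) : Module.Projective Λ₂ (dualTensor k Λ₁ Λ₂ P) := by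
  refine Module.Projective.of_lifting_property'' fun f hf => ?_
  obtain ⟨α, hα⟩ := exists_induced_of_dualTensor
    (LinearMap.id : dualTensor k Λ₁ Λ₂ P →ₗ[Λ₂] dualTensor k Λ₁ Λ₂ P)
  obtain ⟨f', hf'⟩ := exists_inducedMap (k := k) (Λ₁ := Λ₁) f
  have hs : Function.Surjective f' := by
    have : (f' : _ → _) = (f.restrictScalars k).lTensor Λ₁ := funext hf'
    rw [this]
    exact LinearMap.lTensor_surjective _ hf
  obtain ⟨α', hα'⟩ := Module.projective_lifting_property f' α hs
  obtain ⟨ψ, hψ⟩ := exists_dualTensor_of_induced α'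
  refine ⟨ψ, dualTensor_linearMap_ext fun m φ => ?_⟩
  have h1 : f' (α' m) = α m := LinearMap.congr_fun hα' m
  rw [hf'] at h1
  rw [LinearMap.comp_apply, hψ, ← hα, ← h1, evalTensor_lTensor]
  rfl

end

end InductionAdjunction

/-! ### Gorenstein projectives over Λ₁ ⊗ Λ₂ -/

section TensorProductAlgebras

open scoped ModuleCat

variable {k Λ₁ Λ₂ : Type u} [Field k] [Ring Λ₁] [Algebra k Λ₁] [Ring Λ₂] [Algebra k Λ₂]

attribute [local instance] inducedModule

theorem projective_resLeft (P : ModuleCat.{u} (Λ₁ ⊗[k] Λ₂))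
    (hP : Module.Projective (Λ₁ ⊗[k] Λ₂) P) : Module.Projective Λ₁ (resLeft k Λ₁ Λ₂ P) := by
  obtain ⟨s, r, hrs⟩ := exists_retract_inducedModule P hP
  let s' : resLeft k Λ₁ Λ₂ P →ₗ[Λ₁] Λ₁ ⊗[k] (P →₀ Λ₂) :=
    { toFun := s
      map_add' := map_add s
      map_smul' := fun a m => (s.map_smul (a ⊗ₜ 1) m).trans (induced_smul_left a (s m)) }
  let r' : Λ₁ ⊗[k] (P →₀ Λ₂) →ₗ[Λ₁] resLeft k Λ₁ Λ₂ P :=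
    { toFun := r
      map_add' := map_add r
      map_smul' := fun a t =>
        (congrArg r (induced_smul_left a t).symm).trans (r.map_smul (a ⊗ₜ 1) t) }
  exact Module.Projective.of_split s' r' (LinearMap.ext fun x => LinearMap.congr_fun hrs x)

variable {A P X M : ModuleCat.{u} (Λ₁ ⊗[k] Λ₂)}
  {f : A →ₗ[Λ₁ ⊗[k] Λ₂] P} {g : P →ₗ[Λ₁ ⊗[k] Λ₂] X}

theorem extends_resLeftMap_projective
    (hf : ∀ V : ModuleCat.{u} k, Extends (resLeftMap f) (Λ₁ ⊗[k] V))
    (L : ModuleCat.{u} Λ₁) (hL : Module.Projective Λ₁ L) : Extends (resLeftMap f) L := by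
  obtain ⟨s, r, hrs⟩ := exists_retract_tensor (k := k) (Λ₁ := Λ₁) L
  exact (hf (ModuleCat.of k L)).of_retract s r hrs

theorem extVanishes_induced_of_hasProjectiveDimensionLE {Y : ModuleCat.{u} Λ₂}
    (hM : IsExtOrthogonal M) {n : ℕ} (hY : HasProjectiveDimensionLE Y n) (i : ℕ) :
    ExtVanishes (Λ₁ ⊗[k] Λ₂) M (Λ₁ ⊗[k] Y) (i + 1) := by
  induction n generalizing Y i with
  | zero =>
    have := (projective_iff_hasProjectiveDimensionLE_zero _).2 hY
    have : Module.Projective Λ₂ Y := (IsProjective.iff_projective (R := Λ₂) Y).2 this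
    exact hM (ModuleCat.of _ (Λ₁ ⊗[k] Y)) (projective_inducedModule (Y := Y)) i
  | succ n ih =>
    obtain ⟨A, f, g, hs⟩ := exists_isShortExact_free Λ₂ Y
    obtain ⟨f', g', h⟩ := exists_isShortExact_induced (k := k) (Λ₁ := Λ₁) hs
    exact h.extVanishes_target_right
      (hM (ModuleCat.of _ (Λ₁ ⊗[k] (Y →₀ Λ₂))) (projective_inducedModule (Y := Y →₀ Λ₂)) i)
      (ih ((hs.hasProjectiveDimensionLE_succ n).1 hY) (i + 1))

variable [FiniteDimensional k Λ₁]

/-- Ext-orthogonality over Λ₁ plays the role of Tor₁(Hom_k(Λ₁, k), X) = 0. -/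
theorem IsShortExact.dualTensorMap_of_resLeft (h : IsShortExact f g)
    (hX : IsExtOrthogonal (resLeft k Λ₁ Λ₂ X)) :
    IsShortExact (dualTensorMap f) (dualTensorMap g) :=
  h.isShortExact_dualTensorMap (dualTensorMap_injective
    (h.isShortExact_resLeftMap.extends_of_extVanishes
    (hX (ModuleCat.of Λ₁ (Λ₁ ⊗[k] dualTensor k Λ₁ Λ₂ A))
      (inferInstanceAs (Module.Projective Λ₁ (Λ₁ ⊗[k] dualTensor k Λ₁ Λ₂ A))) 0)))

theorem extends_projective
    (hf : ∀ Y : ModuleCat.{u} Λ₂, Module.Projective Λ₂ Y → Extends (dualTensorMap f) Y)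
    (L : ModuleCat.{u} (Λ₁ ⊗[k] Λ₂)) (hL : Module.Projective (Λ₁ ⊗[k] Λ₂) L) : Extends f L := by
  obtain ⟨s, r, hrs⟩ := exists_retract_inducedModule L hL
  exact (extends_induced_iff.2 (hf (ModuleCat.of Λ₂ (L →₀ Λ₂))
    (inferInstanceAs (Module.Projective Λ₂ (L →₀ Λ₂))))).of_retract s r hrs

/-- `Ext¹` of `Hom_k(Λ₁, k) ⊗_{Λ₁} X` vanishes if `Ext¹` into the induced module does. -/
theorem IsShortExact.extVanishes_one_dualTensor (h : IsShortExact f g)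
    (hP : Module.Projective (Λ₁ ⊗[k] Λ₂) P) {Y : ModuleCat.{u} Λ₂}
    (hY : ExtVanishes (Λ₁ ⊗[k] Λ₂) X (Λ₁ ⊗[k] Y) 1) :
    ExtVanishes Λ₂ (dualTensor k Λ₁ Λ₂ X) Y 1 := by
  have hs := isShortExact_subtype (dualTensorMap_surjective h.surj)
  have hP' := projective_dualTensor P hP
  refine hs.extVanishes_one (ExtVanishes.of_projective 0) fun a => ?_
  -- Injectivity of `dualTensorMap f` is not available here, so its image, the kernel of
  -- `dualTensorMap g`, serves as the syzygy.
  let q : dualTensor k Λ₁ Λ₂ A →ₗ[Λ₂] LinearMap.ker (dualTensorMap g) :=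
    (dualTensorMap f).codRestrict _ h.dualTensorMap_exact.apply_apply_eq_zero
  obtain ⟨b, hb⟩ := extends_induced_iff.1 (h.extends_of_extVanishes hY) (a ∘ₗ q)
  refine ⟨b, LinearMap.ext ?_⟩
  rintro ⟨x, hx⟩
  obtain ⟨y, rfl⟩ := (h.dualTensorMap_exact x).1 hx
  exact LinearMap.congr_fun hb y

/-- This needs neither (1) nor (2): a finite projective resolution of Y induces one of Λ₁ ⊗ Y. -/
theorem IsGorensteinProjective.extVanishes_dualTensor (hM : IsGorensteinProjective M)
    {Y : ModuleCat.{u} Λ₂} (hY : HasFiniteProjectiveDimension Y) :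
    ExtVanishes Λ₂ (dualTensor k Λ₁ Λ₂ M) Y 1 := by
  obtain ⟨A, -, P, f, g, hP, hfg, -⟩ := hM.exists_syzygy
  obtain ⟨n, hn⟩ := hY
  exact hfg.extVanishes_one_dualTensor hP
    (extVanishes_induced_of_hasProjectiveDimensionLE hM.isExtOrthogonal hn 0)

theorem IsShortExact.isProperSyzygy_resLeft (h : IsShortExact f g)
    (hP : Module.Projective (Λ₁ ⊗[k] Λ₂) P) (hf : Function.Injective (dualTensorMap f)) :
    IsProperSyzygy (resLeft k Λ₁ Λ₂ A) (resLeft k Λ₁ Λ₂ X) :=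
  ⟨resLeft k Λ₁ Λ₂ P, _, _, projective_resLeft P hP, h.isShortExact_resLeftMap,
    extends_resLeftMap_projective fun _ => extends_resLeftMap_of_injective hf⟩

theorem IsShortExact.isProperSyzygy_dualTensor (h : IsShortExact f g)
    (hP : Module.Projective (Λ₁ ⊗[k] Λ₂) P) (hX : IsGorensteinProjective X)
    (hf : Function.Injective (dualTensorMap f)) :
    IsProperSyzygy (dualTensor k Λ₁ Λ₂ A) (dualTensor k Λ₁ Λ₂ X) :=
  ⟨dualTensor k Λ₁ Λ₂ P, _, _, projective_dualTensor P hP, h.isShortExact_dualTensorMap hf, fun L hL => by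
    have := L.projective_of_categoryTheory_projective
    exact (h.isShortExact_dualTensorMap hf).extends_of_extVanishes (hX.extVanishes_dualTensor
      ⟨0, (projective_iff_hasProjectiveDimensionLE_zero _).1 this⟩)⟩

/-- A class closed under the syzygies and cosyzygies of Gorenstein projective modules after
applying a functor. -/
theorem isGorensteinProjective_of_forall_syzygy {R S : Type u} [Ring R] [Ring S]
    (F : ModuleCat.{u} R → ModuleCat.{u} S)
    (hF : ∀ A P X : ModuleCat.{u} R, ∀ (f : A →ₗ[R] P) (g : P →ₗ[R] X), IsShortExact f g →
      Module.Projective R P → IsGorensteinProjective A → IsGorensteinProjective X →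
      IsProperSyzygy (F A) (F X)) {M : ModuleCat.{u} R} (hM : IsGorensteinProjective M) :
    IsGorensteinProjective (F M) := by
  refine isGorensteinProjective_of_isProperSyzygy
    (fun N => ∃ M, IsGorensteinProjective M ∧ N = F M) ?_ ?_ _ ⟨M, hM, rfl⟩
  · rintro _ ⟨X, hX, rfl⟩
    obtain ⟨A, hA, P, f, g, hP, hfg, -⟩ := hX.exists_syzygy
    exact ⟨F A, ⟨A, hA, rfl⟩, hF A P X f g hfg hP hA hX⟩
  · rintro _ ⟨A, hA, rfl⟩
    obtain ⟨X, hX, P, f, g, hP, hfg, -⟩ := hA.exists_cosyzygy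
    exact ⟨F X, ⟨X, hX, rfl⟩, hF A P X f g hfg hP hA hX⟩

/-- Injectivity keeps Hom_k(Λ₁, k) ⊗_{Λ₁} - exact on the sequences of a total resolution and makes
maps to Λ₁-projectives extend; extension to Λ₂-projectives is then the Ext¹ vanishing above. -/
theorem IsGorensteinProjective.resLeft_dualTensor_of_injective
    (h : ∀ A P X : ModuleCat.{u} (Λ₁ ⊗[k] Λ₂), ∀ (f : A →ₗ[Λ₁ ⊗[k] Λ₂] P)
      (g : P →ₗ[Λ₁ ⊗[k] Λ₂] X), IsShortExact f g → Module.Projective (Λ₁ ⊗[k] Λ₂) P →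
      IsGorensteinProjective A → IsGorensteinProjective X → Function.Injective (dualTensorMap f))
    (hM : IsGorensteinProjective M) : IsGorensteinProjective (resLeft k Λ₁ Λ₂ M) ∧
      IsGorensteinProjective (dualTensor k Λ₁ Λ₂ M) :=
  ⟨isGorensteinProjective_of_forall_syzygy _ (fun A P X f g hfg hP hA hX =>
      hfg.isProperSyzygy_resLeft hP (h A P X f g hfg hP hA hX)) hM,
    isGorensteinProjective_of_forall_syzygy _ (fun A P X f g hfg hP hA hX =>
      hfg.isProperSyzygy_dualTensor hP hX (h A P X f g hfg hP hA hX)) hM⟩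

theorem IsGorensteinProjective.resLeft_dualTensor_of_infiniteSyzygy
    (h : ∀ X : ModuleCat.{u} Λ₁, IsInfiniteSyzygy X → IsGorensteinProjective X)
    (hM : IsGorensteinProjective M) : IsGorensteinProjective (resLeft k Λ₁ Λ₂ M) ∧
      IsGorensteinProjective (dualTensor k Λ₁ Λ₂ M) := by
  refine hM.resLeft_dualTensor_of_injective fun A P X f g hfg hP hA hX => ?_
  have hX' : IsGorensteinProjective (resLeft k Λ₁ Λ₂ X) := by
    refine h _ (isInfiniteSyzygy_of_hasCosyzygyIn (fun N =>
      ∃ M : ModuleCat.{u} (Λ₁ ⊗[k] Λ₂), IsGorensteinProjective M ∧ N = resLeft k Λ₁ Λ₂ M) ?_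
      ⟨X, hX, rfl⟩)
    rintro _ ⟨A, hA, rfl⟩
    obtain ⟨P, X, f, g, hP, hfg, hX⟩ := hA.hasCosyzygyIn
    exact ⟨_, _, _, _, projective_resLeft P hP, hfg.isShortExact_resLeftMap, X, hX, rfl⟩
  exact (hfg.dualTensorMap_of_resLeft hX'.isExtOrthogonal).inj

/-- An embedding of `dualTensor k Λ₁ Λ₂ A` into a projective factors through `dualTensorMap f`,
which is therefore injective. -/
theorem IsGorensteinProjective.resLeft_dualTensor_of_ext
    (h : ∀ X : ModuleCat.{u} Λ₂, (∀ Y : ModuleCat.{u} Λ₂, HasFiniteProjectiveDimension Y →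
      Subsingleton (Abelian.Ext X Y 1)) → IsGorensteinProjective X)
    (hM : IsGorensteinProjective M) : IsGorensteinProjective (resLeft k Λ₁ Λ₂ M) ∧
      IsGorensteinProjective (dualTensor k Λ₁ Λ₂ M) := by
  refine hM.resLeft_dualTensor_of_injective fun A P X f g hfg hP hA hX => ?_
  have hA' : IsGorensteinProjective (dualTensor k Λ₁ Λ₂ A) :=
    h _ fun Y hY => hA.extVanishes_dualTensor hY
  obtain ⟨Y, B, i, q, hY, hi, -⟩ := hA'.hasCosyzygyIn
  obtain ⟨i', hi'⟩ := extends_induced_iff.1 (hfg.extends_of_extVanishes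
    (hX.isExtOrthogonal (ModuleCat.of _ (Λ₁ ⊗[k] Y)) (projective_inducedModule (Y := Y)) 0)) i
  have := hi.inj
  rw [← hi'] at this
  exact Function.Injective.of_comp this

theorem exists_syzygy_of_resLeft_dualTensor
    (h₁ : IsGorensteinProjective (resLeft k Λ₁ Λ₂ M))
    (h₂ : IsGorensteinProjective (dualTensor k Λ₁ Λ₂ M)) :
    ∃ A : ModuleCat.{u} (Λ₁ ⊗[k] Λ₂), (IsGorensteinProjective (resLeft k Λ₁ Λ₂ A) ∧
      IsGorensteinProjective (dualTensor k Λ₁ Λ₂ A)) ∧ IsProperSyzygy A M := by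
  obtain ⟨A, f, g, hfg⟩ := exists_isShortExact_free (Λ₁ ⊗[k] Λ₂) M
  let P : ModuleCat.{u} (Λ₁ ⊗[k] Λ₂) := ModuleCat.of _ (M →₀ Λ₁ ⊗[k] Λ₂)
  have hP : Module.Projective (Λ₁ ⊗[k] Λ₂) P :=
    inferInstanceAs (Module.Projective (Λ₁ ⊗[k] Λ₂) (M →₀ Λ₁ ⊗[k] Λ₂))
  let f' : A →ₗ[Λ₁ ⊗[k] Λ₂] P := f
  let g' : P →ₗ[Λ₁ ⊗[k] Λ₂] M := g
  have hfg' : IsShortExact f' g' := hfg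
  have hd := hfg'.dualTensorMap_of_resLeft h₁.isExtOrthogonal
  exact ⟨A, ⟨h₁.of_syzygy hfg'.isShortExact_resLeftMap (projective_resLeft P hP),
    h₂.of_syzygy hd (projective_dualTensor P hP)⟩, P, f', g', hP, hfg',
    extends_projective fun Y hY => hd.extends_of_extVanishes (h₂.isExtOrthogonal Y hY 0)⟩

theorem exists_cosyzygy_of_resLeft_dualTensor
    (h₁ : IsGorensteinProjective (resLeft k Λ₁ Λ₂ M))
    (h₂ : IsGorensteinProjective (dualTensor k Λ₁ Λ₂ M)) :
    ∃ X : ModuleCat.{u} (Λ₁ ⊗[k] Λ₂), (IsGorensteinProjective (resLeft k Λ₁ Λ₂ X) ∧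
      IsGorensteinProjective (dualTensor k Λ₁ Λ₂ X)) ∧ IsProperSyzygy M X := by
  obtain ⟨Y, B, i, q, hY, hiq, hB⟩ := h₂.hasCosyzygyIn
  let P : ModuleCat.{u} (Λ₁ ⊗[k] Λ₂) := ModuleCat.of _ (Λ₁ ⊗[k] Y)
  have hP : Module.Projective (Λ₁ ⊗[k] Λ₂) P := projective_inducedModule (Y := Y)
  obtain ⟨α, hα⟩ := exists_induced_of_dualTensor i
  -- If α m = 0, then φ ⊗ m = 0 for every φ because i is injective. By adjunction every Λ₁-map from
  -- M to some Λ₁ ⊗ V kills m, yet M embeds over Λ₁ into such a module.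
  have hinj : Function.Injective α := by
    obtain ⟨Q, C, j, p, hQ, hjp, hC⟩ := h₁.hasCosyzygyIn
    obtain ⟨s, r, hrs⟩ := exists_retract_tensor (k := k) (Λ₁ := Λ₁) Q
    obtain ⟨ψ, hψ⟩ := exists_dualTensor_of_linearMap_tensor (s ∘ₗ j)
    have hs : Function.Injective (s ∘ₗ j) :=
      (Function.LeftInverse.injective (g := r) (LinearMap.congr_fun hrs)).comp hjp.inj
    rw [injective_iff_map_eq_zero]
    intro m hm
    have h1 : ∀ φ, dualTmul m φ = 0 := fun φ => hiq.inj (by rw [← hα, hm, map_zero, map_zero])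
    refine hs (Eq.trans (evalTensor_ext fun φ => ?_) (map_zero (s ∘ₗ j)).symm)
    rw [map_zero]
    exact (hψ m φ).symm.trans (by rw [h1, map_zero])
  let X : ModuleCat.{u} (Λ₁ ⊗[k] Λ₂) := ModuleCat.of _ ((Λ₁ ⊗[k] Y) ⧸ LinearMap.range α)
  let π : P →ₗ[Λ₁ ⊗[k] Λ₂] X := (LinearMap.range α).mkQ
  let α' : M →ₗ[Λ₁ ⊗[k] Λ₂] P := α
  have hs : IsShortExact α' π := isShortExact_mkQ hinj
  -- With ψ the adjoint of `a` and ρ a k-linear retraction of i, the map Λ₁ ⊗ (ψ ρ) extends `a`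
  -- along α.
  have hext : ∀ V : ModuleCat.{u} k, Extends (resLeftMap α') (Λ₁ ⊗[k] V) := by
    intro V a
    obtain ⟨ψ, hψ⟩ := exists_dualTensor_of_linearMap_tensor a
    obtain ⟨ρ, hρ⟩ := LinearMap.exists_leftInverse_of_injective (i.restrictScalars k)
      (LinearMap.ker_eq_bot.2 hiq.inj)
    let b : resLeft k Λ₁ Λ₂ P →ₗ[Λ₁] Λ₁ ⊗[k] V :=
      { toFun := fun t => (ψ ∘ₗ ρ).lTensor Λ₁ (show Λ₁ ⊗[k] Y from t)
        map_add' := fun t t' => map_add ((ψ ∘ₗ ρ).lTensor Λ₁) t t'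
        map_smul' := fun c t => (congrArg ((ψ ∘ₗ ρ).lTensor Λ₁)
          (induced_smul_left (Y := Y) (Λ₂ := Λ₂) c t)).trans
            (((ψ ∘ₗ ρ).baseChange Λ₁).map_smul c t) }
    refine ⟨b, LinearMap.ext fun m => evalTensor_ext fun φ => ?_⟩
    have key : ∀ m : M, evalTensor V φ ((ψ ∘ₗ ρ).lTensor Λ₁ (α m)) = ψ (dualTmul m φ) := by
      intro m
      rw [evalTensor_lTensor, hα, LinearMap.comp_apply]
      exact congrArg ψ (LinearMap.congr_fun hρ (dualTmul m φ))
    exact (key m).trans (hψ m φ)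
  have hX₁ : IsGorensteinProjective (resLeft k Λ₁ Λ₂ X) :=
    h₁.of_cosyzygy hs.isShortExact_resLeftMap (projective_resLeft P hP)
      (extends_resLeftMap_projective hext)
  have hd := hs.dualTensorMap_of_resLeft hX₁.isExtOrthogonal
  have hX₂ : IsGorensteinProjective (dualTensor k Λ₁ Λ₂ X) := by
    refine h₂.of_cosyzygy hd (projective_dualTensor P hP) fun L hL a => ?_
    obtain ⟨b, rfl⟩ := hiq.extends_of_extVanishes (hB.isExtOrthogonal L hL 0) a
    -- ε is the counit at Y, and ε ∘ `dualTensorMap α'` = i; so a map extended along i to b extends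
    -- along `dualTensorMap α'` to b ∘ ε.
    obtain ⟨ε, hε⟩ := exists_dualTensor_of_induced (M := P)
      (LinearMap.id : Λ₁ ⊗[k] Y →ₗ[Λ₁ ⊗[k] Λ₂] Λ₁ ⊗[k] Y)
    refine ⟨b ∘ₗ ε, dualTensor_linearMap_ext fun m φ => ?_⟩
    rw [LinearMap.comp_apply, dualTensorMap_dualTmul, LinearMap.comp_apply, LinearMap.comp_apply]
    exact congrArg b ((hε _ φ).trans (hα m φ))
  exact ⟨X, ⟨hX₁, hX₂⟩, P, α', π, hP, hs,
    extends_projective fun Y hY => hd.extends_of_extVanishes (hX₂.isExtOrthogonal Y hY 0)⟩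

theorem isGorensteinProjective_of_resLeft_dualTensor
    (h₁ : IsGorensteinProjective (resLeft k Λ₁ Λ₂ M))
    (h₂ : IsGorensteinProjective (dualTensor k Λ₁ Λ₂ M)) : IsGorensteinProjective M :=
  isGorensteinProjective_of_isProperSyzygy (fun M => IsGorensteinProjective (resLeft k Λ₁ Λ₂ M) ∧
      IsGorensteinProjective (dualTensor k Λ₁ Λ₂ M))
    (fun _ h => exists_syzygy_of_resLeft_dualTensor h.1 h.2)
    (fun _ h => exists_cosyzygy_of_resLeft_dualTensor h.1 h.2) M ⟨h₁, h₂⟩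

end TensorProductAlgebras

/-! ### The equality and its Iwanaga–Gorenstein case -/

theorem mainTheorem5 (k Λ₁ Λ₂ : Type u) [Field k] [Ring Λ₁] [Algebra k Λ₁]
    [FiniteDimensional k Λ₁] [Ring Λ₂] [Algebra k Λ₂] :
    (((∀ X : ModuleCat.{u} Λ₁, IsInfiniteSyzygy X → IsGorensteinProjective X) ∨
      (∀ X : ModuleCat.{u} Λ₂, IsGorensteinProjective X ↔
        ∀ Y : ModuleCat.{u} Λ₂, HasFiniteProjectiveDimension Y →
          Subsingleton (Abelian.Ext X Y 1))) →
      ∀ M : ModuleCat.{u} (Λ₁ ⊗[k] Λ₂),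
        IsGorensteinProjective M ↔
          IsGorensteinProjective (resLeft k Λ₁ Λ₂ M) ∧
          IsGorensteinProjective (dualTensor k Λ₁ Λ₂ M)) ∧
    ((IsIwanagaGorenstein Λ₁ ∨ IsIwanagaGorenstein Λ₂) →
      ∀ M : ModuleCat.{u} (Λ₁ ⊗[k] Λ₂),
        IsGorensteinProjective M ↔
          IsGorensteinProjective (resLeft k Λ₁ Λ₂ M) ∧
          IsGorensteinProjective (dualTensor k Λ₁ Λ₂ M)) := by
  have main : ((∀ X : ModuleCat.{u} Λ₁, IsInfiniteSyzygy X → IsGorensteinProjective X) ∨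
      (∀ X : ModuleCat.{u} Λ₂, IsGorensteinProjective X ↔
        ∀ Y : ModuleCat.{u} Λ₂, HasFiniteProjectiveDimension Y →
          Subsingleton (Abelian.Ext X Y 1))) →
      ∀ M : ModuleCat.{u} (Λ₁ ⊗[k] Λ₂),
        IsGorensteinProjective M ↔
          IsGorensteinProjective (resLeft k Λ₁ Λ₂ M) ∧
          IsGorensteinProjective (dualTensor k Λ₁ Λ₂ M) := by
    intro h M
    refine ⟨fun hM => ?_, fun hM => isGorensteinProjective_of_resLeft_dualTensor hM.1 hM.2⟩
    rcases h with h | h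
    · exact hM.resLeft_dualTensor_of_infiniteSyzygy h
    · exact hM.resLeft_dualTensor_of_ext fun X => (h X).2
  refine ⟨main, fun h => main ?_⟩
  rcases h with h | h
  · exact Or.inl fun X hX => h.isGorensteinProjective_of_isInfiniteSyzygy hX
  · exact Or.inr fun X => h.isGorensteinProjective_iff X
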